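/- For an integer $g\ge 3$ and a finite field $\mathbb F$, equip $\mathbb F^{2g}$ with the symplectic form $\langle (x,y),(z,w)\rangle = x\cdot w-y\cdot z$ $(x,y,z,w\in\mathbb F^g)$. The symplectic spherical building $C_g=C_g(\mathbb F)$ is the pure $(g-1)$-dimensional simplicial complex whose vertices are the nonzero isotropic subspaces of $\mathbb F^{2g}$ (those on which the form vanishes identically) and whose faces are the flags of such subspaces, i.e. the finite sets of them that are totally ordered by inclusion. For a finite pure simplicial complex $X$ of dimension $d\ge 2$, let $\vec X(k)$ be the set of ordered tuples $(v_0,\dots,v_k)$ of distinct vertices with $\{v_0,\dots,v_k\}$ a face of $X$. A random element of $\vec X(k)$ is drawn by picking a $d$-dimensional face of $X$ uniformly at random and then a uniformly random ordered $(k+1)$-tuple of distinct vertices of it. For a (not necessarily abelian) group $\Gamma$, let $C^1(X,\Gamma)$ be the set of $f:\vec X(1)\to\Gamma$ with $f(u,v)=f(v,u)^{-1}$, and for $f\in C^1(X,\Gamma)$ put $\delta f(v,u,w)=f(v,u)f(u,w)f(w,v)$ for $(v,u,w)\in\vec X(2)$. Let $Z^1(X,\Gamma)=\{f\in C^1(X,\Gamma):\delta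 f\equiv 1\}$, and let $B^1(X,\Gamma)$ be the set of all functions $(v,u)\mapsto h(v)h(u)^{-1}$ on $\vec X(1)$ with $h:X(0)\to\Gamma$, where $X(0)$ is the vertex set. Say that $X$ is a $\beta$-coboundary expander ($\beta>0$) if for every group $\Gamma$ one has $Z^1(X,\Gamma)=B^1(X,\Gamma)$ and, for every $f\in C^1(X,\Gamma)$, there is $f'\in Z^1(X,\Gamma)$ with $$\beta\cdot\Pr_{e\in\vec X(1)}\bigl[f(e)\neq f'(e)\bigr]\;\le\;\Pr_{t\in\vec X(2)}\bigl[\delta f(t)\neq 1\bigr].$$ **Theorem.** There is an absolute constant $\beta>0$ such that for every integer $g\ge 3$ and every finite field $\mathbb F$, the symplectic spherical building $C_g(\mathbb F)$ is a $\beta$-coboundary expander (i.e. $h^1(C_g)\ge\beta$, for arbitrary group coefficients). -/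

import Mathlib

universe u v w

namespace SympBuilding

section Expansion

variable {V : Type v}

/-- Oriented `k`-faces: ordered tuples `(v₀, …, v_k)` of distinct vertices with
`{v₀, …, v_k}` a face of `X`. -/
def OrientedFace (X : AbstractSimplicialComplex V) (k : ℕ) : Type v :=
  {s : Fin (k + 1) ↪ V // Finset.univ.map s ∈ X.faces}

/-- The underlying (unordered) face. -/
def OrientedFace.toFinset {X : AbstractSimplicialComplex V} {k : ℕ} (s : OrientedFace X k) :
    Finset V :=
  Finset.univ.map s.1

/-- The vertex in position `i`. -/
def OrientedFace.vertex {X : AbstractSimplicialComplex V} {k : ℕ} (s : OrientedFace X k)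
    (i : Fin (k + 1)) : V :=
  s.1 i

/-- The oriented edge `(v_i, v_j)` of the oriented face `(v₀, …, v_k)`. -/
def OrientedFace.edge {X : AbstractSimplicialComplex V} {k : ℕ} (s : OrientedFace X k)
    (i j : Fin (k + 1)) (hij : i ≠ j) : OrientedFace X 1 :=
  ⟨⟨![s.1 i, s.1 j], by
      intro a b hab
      have h1 : s.1 i ≠ s.1 j := fun h => hij (s.1.injective h)
      fin_cases a <;> fin_cases b <;> simp_all⟩, by
    refine (X.isRelLowerSet_faces s.2).2 ?_ (by simp)
    intro x hx
    obtain ⟨a, -, rfl⟩ := Finset.mem_map.1 hx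
    fin_cases a
    · exact Finset.mem_map.2 ⟨i, Finset.mem_univ i, rfl⟩
    · exact Finset.mem_map.2 ⟨j, Finset.mem_univ j, rfl⟩⟩

/-- `1`-cochains `f` with coefficients in a (possibly non-abelian) group:
`f (u, v) = (f (v, u))⁻¹` on all oriented edges. -/
def Cochain1 (X : AbstractSimplicialComplex V) (Γ : Type w) [Group Γ] : Type (max v w) :=
  {f : OrientedFace X 1 → Γ // ∀ e, f e = (f (e.edge 1 0 (by decide)))⁻¹}

/-- The coboundary `(δ₀ h) (v, u) = h v * (h u)⁻¹` of `h : X(0) → Γ`. Every element of the type `V`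
is a vertex of `X`. -/
def delta0 (X : AbstractSimplicialComplex V) {Γ : Type w} [Group Γ] (h : V → Γ) : Cochain1 X Γ :=
  ⟨fun e => h (e.vertex 0) * (h (e.vertex 1))⁻¹, fun e => by
    change _ = (h (e.vertex 1) * (h (e.vertex 0))⁻¹)⁻¹
    rw [mul_inv_rev, inv_inv]⟩

/-- The coboundary `(δ₁ f) (v, u, w) = f (v, u) * f (u, w) * f (w, v)`, as a function on
oriented triangles. -/
def delta1 {X : AbstractSimplicialComplex V} {Γ : Type w} [Group Γ] (f : Cochain1 X Γ) :
    OrientedFace X 2 → Γ :=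
  fun t => f.1 (t.edge 0 1 (by decide)) * f.1 (t.edge 1 2 (by decide)) *
    f.1 (t.edge 2 0 (by decide))

/-- The `1`-cocycles `Z¹(X, Γ)`. -/
def Z1 (X : AbstractSimplicialComplex V) (Γ : Type w) [Group Γ] : Set (Cochain1 X Γ) :=
  {f | ∀ t, delta1 f t = 1}

/-- The `1`-coboundaries `B¹(X, Γ)`. -/
def B1 (X : AbstractSimplicialComplex V) (Γ : Type w) [Group Γ] : Set (Cochain1 X Γ) :=
  Set.range (delta0 X)

/-- Pairs `(σ, s)` of a top-level (i.e. inclusion-maximal) face `σ` and an ordering `s` of a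
`k`-dimensional face contained in `σ`. -/
def TopPair (X : AbstractSimplicialComplex V) (k : ℕ) : Type v :=
  {p : Finset V × OrientedFace X k // Maximal (· ∈ X.faces) p.1 ∧ p.2.toFinset ⊆ p.1}

/-- The probability of the event `E` for a random oriented `k`-face of a finite pure complex: pick a
top-level face uniformly, then an ordered `(k+1)`-tuple of distinct vertices of it uniformly. In a
pure complex all top-level faces have the same number of vertices, so this is the uniform
distribution on `TopPair X k`. -/
noncomputable def prob (X : AbstractSimplicialComplex V) (k : ℕ) (E : OrientedFace X k → Prop) :
    ℝ :=
  (Nat.card {p : TopPair X k // E p.1.2} : ℝ) / (Nat.card (TopPair X k) : ℝ)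

/-- The normalized distance of two functions on oriented `k`-faces. -/
noncomputable def cochainDist {X : AbstractSimplicialComplex V} {k : ℕ} {Γ : Type w}
    (f g : OrientedFace X k → Γ) : ℝ :=
  prob X k fun s => f s ≠ g s

/-- The weight `dist(f, 1)`. -/
noncomputable def wt {X : AbstractSimplicialComplex V} {k : ℕ} {Γ : Type w} [Group Γ]
    (f : OrientedFace X k → Γ) : ℝ :=
  cochainDist f fun _ => 1

/-- `β`-cocycle expansion in degree `1`, over all coefficient groups. -/
def IsCocycleExpander (X : AbstractSimplicialComplex V) (β : ℝ) : Prop :=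
  ∀ (Γ : Type w) [Group Γ] (f : Cochain1 X Γ),
    ∃ g ∈ Z1 X Γ, β * cochainDist f.1 g.1 ≤ wt (delta1 f)

/-- `β`-coboundary expansion in degree `1`, over all coefficient groups: `β`-cocycle expansion, and
every `1`-cocycle is a `1`-coboundary. -/
def IsCoboundaryExpander (X : AbstractSimplicialComplex V) (β : ℝ) : Prop :=
  IsCocycleExpander.{v, w} X β ∧ ∀ (Γ : Type w) [Group Γ], Z1 X Γ = B1 X Γ

end Expansion

section Building

variable (F : Type u) [Field F] (g : ℕ)

/-- The space `F^{2g}`, with vectors written as pairs `(x, y)`, `x, y ∈ F^g`. -/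
abbrev Space : Type u := (Fin g → F) × (Fin g → F)

/-- The standard symplectic form `⟨(x, y), (z, w)⟩ = x ⬝ w - y ⬝ z`. -/
def form : LinearMap.BilinForm F (Space F g) :=
  LinearMap.mk₂ F (fun a b => a.1 ⬝ᵥ b.2 - a.2 ⬝ᵥ b.1)
    (fun a a' b => by simp only [Prod.fst_add, Prod.snd_add, add_dotProduct]; ring)
    (fun c a b => by simp only [Prod.smul_fst, Prod.smul_snd, smul_dotProduct, smul_sub])
    (fun a b b' => by simp only [Prod.fst_add, Prod.snd_add, dotProduct_add]; ring)
    (fun c a b => by simp only [Prod.smul_fst, Prod.smul_snd, dotProduct_smul, smul_sub])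

/-- Isotropic subspaces: the form vanishes identically on them. -/
def IsIsotropic (U : Submodule F (Space F g)) : Prop :=
  ∀ x ∈ U, ∀ y ∈ U, form F g x y = 0

/-- The vertices of the building: the nonzero isotropic subspaces. -/
def Vertex : Type u := {U : Submodule F (Space F g) // U ≠ ⊥ ∧ IsIsotropic F g U}

/-- The symplectic spherical building `C_g` over `F`: its faces are the flags (nonempty finite
sets of nonzero isotropic subspaces that are totally ordered by inclusion). -/
def symplecticBuilding : AbstractSimplicialComplex (Vertex F g) where
  faces := {s | s.Nonempty ∧ ∀ U ∈ s, ∀ W ∈ s, U.1 ≤ W.1 ∨ W.1 ≤ U.1}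
  isRelLowerSet_faces := by
    rintro s ⟨hs, hc⟩
    exact ⟨hs, fun t hts ht => ⟨ht, fun U hU W hW => hc U (hts hU) W (hts hW)⟩⟩
  singleton_mem := by
    intro U
    refine ⟨Finset.singleton_nonempty U, fun A hA B hB => ?_⟩
    rw [Finset.mem_singleton] at hA hB
    subst hA
    subst hB
    exact Or.inl le_rfl

end Building

end SympBuilding

open scoped Pointwise
open Module

namespace SympBuilding

/-! ### Symplectic linear algebra: orthogonal complements, isotropic frames, Witt extension. -/

section Symplectic

variable {F : Type u} [Field F] {g : ℕ}

/-! By Witt's theorem the isometry group is transitive on isotropic flags of a given dimension type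
(`exists_smul_stdFlag_eq`), so a random oriented face is a random translate of a random tuple from
the standard flag (`prob_eq`). There are of order g² edge types and g³ triangle types. After
normalization one therefore needs a function h such that the total weight, over all edge types, of
the edges where the cochain differs from the coboundary of h is at most a constant over g times the
total weight of the violated triangles. This is `exists_total_le`, with m of order g/6.

The geometric device is the path U ≥ U ∩ W^⊥ ≤ (U ∩ W^⊥) + W ≥ W, whose middle vertices are `mid U
W` and `hinge U W`. It is monotone in U, so for U ≤ U' the paths from U and U' to a common W,
together with the edge UU', bound a loop filled by five triangles (`ind_badEdge_coneFn_le`). If W is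
in random position and dim W ≤ dim U, then dim (W ∩ U^⊥) has geometric tails, uniformly in g and the
field (`card_finrank_inf_perp_tail`). For each fixed deviation from generic position, the type of a
filling triangle determines (dim U, dim U', dim W). Hence no triangle type is overused, and
averaging costs a constant only (`sum_le_tailConst_mul`).

Coning from the best W of dimension at most m settles all edges between dimensions above m
(`exists_highTotal_le`). Below that, U ∩ W^⊥ may vanish. There a vertex v of dimension at most m
gets the best of the values φ(v,w) h(w) proposed by larger w; two proposals are compared along a
hinge path in the link of v (`ind_ne_le_of_hinge`, `exists_low_value`). The edges still missing are
bounded through a third vertex of large dimension (`edgeWeight_le_of_apex`).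

Only products along paths occur, so the coefficient group may be non-abelian. The equality of
cocycles and coboundaries follows from the inequality, because every edge has positive probability.
-/

lemma form_apply (x y : Space F g) : form F g x y = x.1 ⬝ᵥ y.2 - x.2 ⬝ᵥ y.1 := rfl

lemma form_isAlt : (form F g).IsAlt := fun x => by
  rw [form_apply, dotProduct_comm x.2 x.1, sub_self]

lemma form_swap (x y : Space F g) : form F g x y = -form F g y x := (LinearMap.BilinForm.IsAlt.neg_eq form_isAlt y x).symm

lemma form_nondegenerate : (form F g).Nondegenerate := by
  have key : ∀ x : Space F g, (∀ y, form F g x y = 0) → x = 0 := by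
    intro x hx
    have h1 : x.1 = 0 := by
      funext i
      have := hx (0, Pi.single i 1)
      simpa [form_apply] using this
    have h2 : x.2 = 0 := by
      funext i
      have := hx (Pi.single i 1, 0)
      simpa [form_apply] using this
    exact Prod.ext h1 h2
  refine ⟨key, fun y hy => key y fun x => ?_⟩
  rw [form_swap, hy, neg_zero]

variable (F g) in
lemma finrank_space : finrank F (Space F g) = 2 * g := by
  simp [two_mul]

/-- The orthogonal complement of a subspace for the symplectic form. -/
abbrev perp (W : Submodule F (Space F g)) : Submodule F (Space F g) := (form F g).orthogonal W

lemma mem_perp {W : Submodule F (Space F g)} {x : Space F g} :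
    x ∈ perp W ↔ ∀ y ∈ W, form F g y x = 0 := Iff.rfl

lemma finrank_perp (W : Submodule F (Space F g)) : finrank F (perp W) = 2 * g - finrank F W := by
  rw [LinearMap.BilinForm.finrank_orthogonal form_nondegenerate, finrank_space]

lemma finrank_le_two_mul (W : Submodule F (Space F g)) : finrank F W ≤ 2 * g := by
  rw [← finrank_space F g]; exact Submodule.finrank_le W

lemma perp_perp (W : Submodule F (Space F g)) : perp (perp W) = W :=
  LinearMap.BilinForm.orthogonal_orthogonal form_nondegenerate form_isAlt.isRefl W

lemma perp_sup (U W : Submodule F (Space F g)) : perp (U ⊔ W) = perp U ⊓ perp W := by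
  apply le_antisymm
  · exact le_inf (LinearMap.BilinForm.orthogonal_le le_sup_left)
      (LinearMap.BilinForm.orthogonal_le le_sup_right)
  · rintro x ⟨h1, h2⟩ y hy
    obtain ⟨a, ha, b, hb, rfl⟩ := Submodule.mem_sup.1 hy
    have e1 := mem_perp.1 h1 a ha
    have e2 := mem_perp.1 h2 b hb
    change form F g (a + b) x = 0
    rw [map_add, LinearMap.add_apply, e1, e2, add_zero]

/-- Both dim U - dim (U ∩ W^⊥) and dim W - dim (W ∩ U^⊥) are the rank of the pairing between U and
W. -/
lemma finrank_inf_perp (U W : Submodule F (Space F g)) :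
    finrank F ↑(U ⊓ perp W) + finrank F W = finrank F U + finrank F ↑(W ⊓ perp U) := by
  have h1 : perp (perp U ⊔ W) = U ⊓ perp W := by rw [perp_sup, perp_perp]
  have h2 := finrank_perp (perp U ⊔ W)
  rw [h1] at h2
  have h3 := Submodule.finrank_sup_add_finrank_inf_eq (perp U) W
  rw [finrank_perp, inf_comm] at h3
  have h4 := finrank_le_two_mul (perp U ⊔ W)
  have h5 := finrank_le_two_mul U
  omega

lemma isIsotropic_iff_le_perp {U : Submodule F (Space F g)} : IsIsotropic F g U ↔ U ≤ perp U :=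
  ⟨fun h x hx y hy => h y hy x hx, fun h x hx y hy => h hy x hx⟩

lemma IsIsotropic.mono {U W : Submodule F (Space F g)} (h : IsIsotropic F g W) (hU : U ≤ W) :
    IsIsotropic F g U := fun x hx y hy => h x (hU hx) y (hU hy)

lemma IsIsotropic.finrank_le {U : Submodule F (Space F g)} (h : IsIsotropic F g U) :
    finrank F U ≤ g := by
  have h1 := Submodule.finrank_mono (isIsotropic_iff_le_perp.1 h)
  rw [finrank_perp] at h1
  have := finrank_le_two_mul U
  omega

lemma isIsotropic_sup {U W : Submodule F (Space F g)} (hU : IsIsotropic F g U)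
    (hW : IsIsotropic F g W) (h : U ≤ perp W) : IsIsotropic F g (U ⊔ W) := by
  rw [isIsotropic_iff_le_perp] at *
  have h' : W ≤ perp U := by
    rw [← perp_perp W]; exact LinearMap.BilinForm.orthogonal_le h
  rw [perp_sup]
  exact sup_le (le_inf hU h) (le_inf h' hW)

variable (F g) in
/-- The group of isometries of the symplectic form. -/
def isomGroup : Subgroup (Space F g ≃ₗ[F] Space F g) where
  carrier := {T | ∀ x y, form F g (T x) (T y) = form F g x y}
  one_mem' := fun _ _ => rfl
  mul_mem' := fun {S T} hS hT x y => by
    rw [LinearEquiv.mul_apply, LinearEquiv.mul_apply, hS, hT]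
  inv_mem' := fun {S} hS x y => by
    have := hS (S⁻¹ x) (S⁻¹ y)
    rw [← LinearEquiv.mul_apply, ← LinearEquiv.mul_apply, mul_inv_cancel] at this
    exact this.symm

lemma form_smul (γ : isomGroup F g) (x y : Space F g) :
    form F g (γ • x) (γ • y) = form F g x y := γ.2 x y

instance [Finite F] : Finite (isomGroup F g) :=
  Finite.of_injective (fun γ : isomGroup F g => (fun x => γ.1 x : Space F g → Space F g))
    fun a b h => Subtype.ext (LinearEquiv.ext fun x => congrFun h x)

variable (F) in
/-- The standard isotropic basis vectors. -/
def stdVec (i : Fin g) : Space F g := (Pi.single i 1, 0)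

variable (F g) in
/-- The standard isotropic flag. -/
def stdFlag (k : ℕ) : Submodule F (Space F g) := Submodule.span F (stdVec F '' {i | i.val < k})

lemma linearIndependent_stdVec : LinearIndependent F (stdVec F (g := g)) := by
  have h : LinearIndependent F (fun i : Fin g => (Pi.single i 1 : Fin g → F)) :=
    Pi.linearIndependent_single_one (Fin g) F
  exact h.map' (LinearMap.inl F (Fin g → F) (Fin g → F)) (LinearMap.ker_eq_bot.2 LinearMap.inl_injective)

lemma form_stdVec (i j : Fin g) : form F g (stdVec F i) (stdVec F j) = 0 := by
  simp [form_apply, stdVec]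

lemma finrank_stdFlag {k : ℕ} (hk : k ≤ g) : finrank F (stdFlag F g k) = k := by
  have h1 : stdFlag F g k = Submodule.span F (Set.range fun i : Fin k => stdVec F (Fin.castLE hk i)) := by
    rw [stdFlag]
    congr 1
    ext x
    constructor
    · rintro ⟨i, hi, rfl⟩
      exact ⟨⟨i, hi⟩, rfl⟩
    · rintro ⟨i, rfl⟩
      exact ⟨_, i.2, rfl⟩
  rw [h1, finrank_span_eq_card, Fintype.card_fin]
  exact linearIndependent_stdVec.comp _ (Fin.castLE_injective hk)

lemma stdFlag_mono {k l : ℕ} (h : k ≤ l) : stdFlag F g k ≤ stdFlag F g l :=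
  Submodule.span_mono (Set.image_mono fun _ hi => lt_of_lt_of_le hi h)

lemma stdFlag_zero : stdFlag F g 0 = ⊥ := by simp [stdFlag]

lemma isIsotropic_span {s : Set (Space F g)} (h : ∀ x ∈ s, ∀ y ∈ s, form F g x y = 0) :
    IsIsotropic F g (Submodule.span F s) := by
  rw [isIsotropic_iff_le_perp, Submodule.span_le]
  intro x hx
  change x ∈ perp _
  rw [mem_perp]
  intro y hy
  induction hy using Submodule.span_induction with
  | mem y hy => exact h y hy x hx
  | zero => simp
  | add a b _ _ ha hb => rw [map_add, LinearMap.add_apply, ha, hb, add_zero]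
  | smul c a _ ha => rw [map_smul, LinearMap.smul_apply, ha, smul_zero]

lemma isIsotropic_stdFlag (k : ℕ) : IsIsotropic F g (stdFlag F g k) := by
  apply isIsotropic_span
  rintro _ ⟨i, -, rfl⟩ _ ⟨j, -, rfl⟩
  exact form_stdVec i j

lemma exists_dual_isotropic {x : Fin g → Space F g} (hx : LinearIndependent F x)
    (hiso : ∀ i j, form F g (x i) (x j) = 0) :
    ∃ y : Fin g → Space F g, (∀ i j, form F g (x i) (y j) = if i = j then 1 else 0) ∧
      ∀ i j, form F g (y i) (y j) = 0 := by
  have hsurj : ∀ j, ∃ y, ∀ i, form F g (x i) y = if i = j then 1 else 0 := by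
    let Φ : Space F g →ₗ[F] (Fin g → F) := LinearMap.pi fun i => form F g (x i)
    have hker : LinearMap.ker Φ = perp (Submodule.span F (Set.range x)) := by
      ext z
      rw [LinearMap.mem_ker, mem_perp]
      constructor
      · intro h y hy
        induction hy using Submodule.span_induction with
        | mem y hy => obtain ⟨i, rfl⟩ := hy; exact congrFun h i
        | zero => simp
        | add a b _ _ ha hb => rw [map_add, LinearMap.add_apply, ha, hb, add_zero]
        | smul c a _ ha => rw [map_smul, LinearMap.smul_apply, ha, smul_zero]
      · intro h
        funext i
        exact h _ (Submodule.subset_span ⟨i, rfl⟩)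
    have h2 := LinearMap.finrank_range_add_finrank_ker Φ
    rw [hker, finrank_perp, finrank_span_eq_card hx, Fintype.card_fin, finrank_space] at h2
    have h3 : LinearMap.range Φ = ⊤ := by
      apply Submodule.eq_top_of_finrank_eq
      rw [finrank_fin_fun]
      omega
    intro j
    obtain ⟨y, hy⟩ := LinearMap.range_eq_top.1 h3 (fun i => if i = j then 1 else 0)
    exact ⟨y, fun i => congrFun hy i⟩
  choose y hy using hsurj
  -- Correcting each y by multiples of the x's removes the products of the y's. Using only the pairs
  -- j < k avoids halving, so characteristic 2 is covered.
  let c : Fin g → Fin g → F := fun j k => if j < k then form F g (y j) (y k) else 0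
  have hyx : ∀ j i, form F g (y j) (x i) = if i = j then -1 else 0 := by
    intro j i
    rw [form_swap, hy]
    split_ifs <;> simp
  refine ⟨fun j => y j + ∑ i, c i j • x i, fun i j => ?_, fun j k => ?_⟩
  · simp [map_add, map_sum, hiso, hy]
  · simp only [map_add, map_sum, map_smul, LinearMap.add_apply, LinearMap.sum_apply,
      LinearMap.smul_apply, hiso, hy, hyx, smul_eq_mul, mul_zero, Finset.sum_const_zero, add_zero,
      mul_ite, mul_one, mul_neg, Finset.sum_ite_eq, Finset.sum_ite_eq', Finset.mem_univ, if_true, c]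
    rcases lt_trichotomy j k with h | h | h
    · simp [h, h.not_gt]
    · subst h
      simpa using form_isAlt (y j)
    · rw [form_swap (y j) (y k)]
      simp [h, h.not_gt]

/-- The frame and a dual isotropic frame form a symplectic basis; sending the standard basis to it
preserves the form, and nondegeneracy then gives injectivity. -/
lemma exists_isometry_of_frame {x : Fin g → Space F g} (hx : LinearIndependent F x)
    (hiso : ∀ i j, form F g (x i) (x j) = 0) :
    ∃ γ : isomGroup F g, ∀ i, γ • stdVec F i = x i := by
  obtain ⟨y, hxy, hyy⟩ := exists_dual_isotropic hx hiso
  have hyx : ∀ j i, form F g (y j) (x i) = if i = j then -1 else 0 := by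
    intro j i
    rw [form_swap, hxy]
    split_ifs <;> simp
  let T : Space F g →ₗ[F] Space F g :=
    (Fintype.linearCombination F x).coprod (Fintype.linearCombination F y)
  have hT : ∀ a, T a = ∑ i, a.1 i • x i + ∑ i, a.2 i • y i := fun a => by
    simp [T, LinearMap.coprod_apply, Fintype.linearCombination_apply]
  have hform : ∀ a b, form F g (T a) (T b) = form F g a b := by
    intro a b
    rw [hT, hT, form_apply a b]
    simp only [map_add, map_sum, map_smul, LinearMap.add_apply, LinearMap.sum_apply,
      LinearMap.smul_apply, hiso, hyy, hxy, hyx, smul_eq_mul, mul_zero, Finset.sum_const_zero,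
      mul_ite, mul_one, mul_neg, Finset.sum_ite_eq, Finset.sum_ite_eq', Finset.mem_univ, if_true,
      add_zero, zero_add, dotProduct, Finset.sum_neg_distrib]
    rw [sub_eq_add_neg, add_comm]
    congr 1
    · exact Finset.sum_congr rfl fun i _ => mul_comm _ _
    · congr 1
      exact Finset.sum_congr rfl fun i _ => mul_comm _ _
  have hinj : Function.Injective T := by
    rw [← LinearMap.ker_eq_bot, LinearMap.ker_eq_bot']
    intro a ha
    refine form_nondegenerate.1 a fun b => ?_
    rw [← hform, ha, map_zero, LinearMap.zero_apply]
  refine ⟨⟨LinearEquiv.ofInjectiveEndo T hinj, hform⟩, fun i => ?_⟩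
  change T (stdVec F i) = x i
  rw [hT]
  simp [stdVec, Pi.single_apply]

/-- Witt's theorem for isotropic frames. -/
lemma exists_isometry {k : ℕ} (hk : k ≤ g) {x : Fin k → Space F g} (hx : LinearIndependent F x)
    (hiso : ∀ i j, form F g (x i) (x j) = 0) :
    ∃ γ : isomGroup F g, ∀ i, γ • stdVec F (Fin.castLE hk i) = x i := by
  obtain ⟨d, hd⟩ := Nat.exists_eq_add_of_le hk
  induction d generalizing k with
  | zero =>
    obtain rfl : k = g := by omega
    exact exists_isometry_of_frame hx hiso
  | succ d ih =>
    have hspan := isIsotropic_span (s := Set.range x) (by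
      rintro _ ⟨i, rfl⟩ _ ⟨j, rfl⟩; exact hiso i j)
    -- An isotropic subspace of dimension k < g is strictly smaller than its complement, of
    -- dimension 2g - k, so the frame can be lengthened by one vector.
    have hlt : Submodule.span F (Set.range x) < perp (Submodule.span F (Set.range x)) := by
      refine lt_of_le_of_ne (isIsotropic_iff_le_perp.1 hspan) fun h => ?_
      have h1 := finrank_perp (Submodule.span F (Set.range x))
      rw [← h, finrank_span_eq_card hx, Fintype.card_fin] at h1
      omega
    obtain ⟨y, hy, hny⟩ := SetLike.exists_of_lt hlt
    have hxy : ∀ i, form F g (x i) y = 0 := fun i => hy _ (Submodule.subset_span ⟨i, rfl⟩)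
    obtain ⟨γ, hγ⟩ := ih (k := k + 1) (by omega) (x := Fin.snoc x y)
      (by rw [linearIndependent_finSnoc]; exact ⟨hx, hny⟩)
      (by
        intro i j
        refine Fin.lastCases ?_ (fun i => ?_) i <;> refine Fin.lastCases ?_ (fun j => ?_) j
        · simpa using form_isAlt y
        · simp [form_swap y, hxy]
        · simp [hxy]
        · simpa using hiso i j) (by omega)
    refine ⟨γ, fun i => ?_⟩
    have := hγ i.castSucc
    rwa [Fin.snoc_castSucc] at this

end Symplectic

/-! ### Action of the isometry group on subspaces and transitivity on flags. -/

section Action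

variable {F : Type u} [Field F] {g : ℕ}

lemma mem_smul_iff {γ : isomGroup F g} {U : Submodule F (Space F g)} {x : Space F g} :
    x ∈ γ • U ↔ γ⁻¹ • x ∈ U := by
  constructor
  · rintro ⟨y, hy, rfl⟩
    change γ⁻¹ • γ • y ∈ U
    rwa [inv_smul_smul]
  · intro h
    exact ⟨_, h, smul_inv_smul γ x⟩

lemma smul_mem_smul {γ : isomGroup F g} {U : Submodule F (Space F g)} {x : Space F g} (h : x ∈ U) :
    γ • x ∈ γ • U := ⟨x, h, rfl⟩

lemma smul_le_iff {γ : isomGroup F g} {U W : Submodule F (Space F g)} :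
    γ • U ≤ W ↔ ∀ x ∈ U, γ • x ∈ W :=
  ⟨fun h _ hx => h (smul_mem_smul hx), fun h _ hx => by
    obtain ⟨y, hy, rfl⟩ := hx
    exact h y hy⟩

lemma smul_inf_eq (γ : isomGroup F g) (U W : Submodule F (Space F g)) :
    γ • (U ⊓ W) = γ • U ⊓ γ • W := by
  ext x
  simp only [Submodule.mem_inf, mem_smul_iff]

lemma smul_perp (γ : isomGroup F g) (U : Submodule F (Space F g)) :
    γ • perp U = perp (γ • U) := by
  ext x
  rw [mem_smul_iff, mem_perp, mem_perp]
  constructor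
  · intro h y hy
    rw [mem_smul_iff] at hy
    rw [← form_smul γ⁻¹]
    exact h _ hy
  · intro h y hy
    rw [← form_smul γ, smul_inv_smul]
    exact h _ (smul_mem_smul hy)

lemma smul_le_smul_iff' {γ : isomGroup F g} {U W : Submodule F (Space F g)} :
    γ • U ≤ γ • W ↔ U ≤ W := by
  constructor
  · intro h x hx
    have := h (smul_mem_smul (γ := γ) hx)
    rwa [mem_smul_iff, inv_smul_smul] at this
  · intro h x hx
    rw [mem_smul_iff] at *
    exact h hx

lemma finrank_smul (γ : isomGroup F g) (U : Submodule F (Space F g)) :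
    finrank F ↑(γ • U) = finrank F U :=
  LinearEquiv.finrank_map_eq γ.1 U

lemma IsIsotropic.smul {U : Submodule F (Space F g)} (h : IsIsotropic F g U) (γ : isomGroup F g) :
    IsIsotropic F g (γ • U) := by
  rw [isIsotropic_iff_le_perp] at *
  rw [← smul_perp]
  exact smul_le_smul_iff'.2 h

lemma smul_stdFlag_le_iff {γ : isomGroup F g} {k : ℕ} {U : Submodule F (Space F g)} :
    γ • stdFlag F g k ≤ U ↔ ∀ i : Fin g, i.val < k → γ • stdVec F i ∈ U := by
  rw [smul_le_iff]
  constructor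
  · intro h i hi
    exact h _ (Submodule.subset_span ⟨i, hi, rfl⟩)
  · intro h
    change stdFlag F g k ≤ U.comap (γ.1 : Space F g →ₗ[F] Space F g)
    rw [stdFlag, Submodule.span_le]
    rintro _ ⟨i, hi, rfl⟩
    exact h i hi

lemma smul_stdFlag_congr {γ δ : isomGroup F g} {k : ℕ}
    (h : ∀ i : Fin g, i.val < k → γ • stdVec F i = δ • stdVec F i) :
    γ • stdFlag F g k = δ • stdFlag F g k := by
  have aux : ∀ {γ δ : isomGroup F g}, (∀ i : Fin g, i.val < k → γ • stdVec F i = δ • stdVec F i) →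
      γ • stdFlag F g k ≤ δ • stdFlag F g k := by
    intro γ δ h
    rw [smul_stdFlag_le_iff]
    intro i hi
    rw [h i hi]
    exact smul_mem_smul (Submodule.subset_span ⟨i, hi, rfl⟩)
  exact le_antisymm (aux h) (aux fun i hi => (h i hi).symm)

/-- An isotropic vector orthogonal to `γ • stdFlag n` and outside it can be made the next vector
of the frame. -/
lemma exists_extend_vector (γ₀ : isomGroup F g) {n : ℕ} (hn : n < g) {y : Space F g}
    (hy : y ∈ perp (γ₀ • stdFlag F g n)) (hny : y ∉ γ₀ • stdFlag F g n) :
    ∃ γ : isomGroup F g, (∀ i : Fin g, i.val < n → γ • stdVec F i = γ₀ • stdVec F i) ∧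
      γ • stdVec F ⟨n, hn⟩ = y := by
  let x : Fin n → Space F g := fun i => γ₀ • stdVec F (Fin.castLE hn.le i)
  have hmem : ∀ i, x i ∈ γ₀ • stdFlag F g n := fun i =>
    smul_mem_smul (Submodule.subset_span ⟨_, i.2, rfl⟩)
  have hx : LinearIndependent F x := by
    have h0 := linearIndependent_stdVec (F := F).comp _ (Fin.castLE_injective hn.le)
    exact h0.map' γ₀.1.toLinearMap (LinearMap.ker_eq_bot.2 γ₀.1.injective)
  have hxy : ∀ i, form F g (x i) y = 0 := fun i => hy _ (hmem i)
  obtain ⟨γ, hγ⟩ := exists_isometry (k := n + 1) hn (x := Fin.snoc x y)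
    (by
      rw [linearIndependent_finSnoc]
      refine ⟨hx, fun h => hny (Submodule.span_le.2 ?_ h)⟩
      rintro _ ⟨i, rfl⟩
      exact hmem i)
    (by
      intro i j
      refine Fin.lastCases ?_ (fun i => ?_) i <;> refine Fin.lastCases ?_ (fun j => ?_) j
      · simpa using form_isAlt y
      · simp [form_swap y, hxy]
      · simp [hxy]
      · simp [x, form_smul, form_stdVec])
  refine ⟨γ, fun i hi => ?_, ?_⟩
  · have := hγ (Fin.castSucc ⟨i, hi⟩)
    rwa [Fin.snoc_castSucc] at this
  · have := hγ (Fin.last n)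
    rwa [Fin.snoc_last] at this

lemma exists_extend_flag (γ₀ : isomGroup F g) {n : ℕ} {U : Submodule F (Space F g)}
    (hU : IsIsotropic F g U) (hle : γ₀ • stdFlag F g n ≤ U) (hn : n < finrank F U) :
    ∃ γ : isomGroup F g, (∀ k ≤ n, γ • stdFlag F g k = γ₀ • stdFlag F g k) ∧
      γ • stdFlag F g (n + 1) ≤ U := by
  have hng : n < g := hn.trans_le hU.finrank_le
  have hlt : γ₀ • stdFlag F g n < U := by
    refine lt_of_le_of_ne hle fun h => ?_
    rw [← h, finrank_smul, finrank_stdFlag hng.le] at hn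
    exact lt_irrefl _ hn
  obtain ⟨y, hyU, hny⟩ := SetLike.exists_of_lt hlt
  obtain ⟨γ, h1, h2⟩ := exists_extend_vector γ₀ hng (fun z hz => hU z (hle hz) y hyU) hny
  refine ⟨γ, fun k hk => smul_stdFlag_congr fun i hi => h1 i (hi.trans_le hk), ?_⟩
  rw [smul_stdFlag_le_iff]
  intro i hi
  rcases Nat.lt_succ_iff_lt_or_eq.1 hi with hi | hi
  · rw [h1 i hi]
    exact hle (smul_mem_smul (Submodule.subset_span ⟨i, hi, rfl⟩))
  · obtain rfl : i = ⟨n, hng⟩ := Fin.ext hi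
    rwa [h2]

/-- Every flag of isotropic subspaces is part of a translate of the standard flag. -/
lemma exists_smul_stdFlag_eq (s : Set (Submodule F (Space F g)))
    (hiso : ∀ U ∈ s, IsIsotropic F g U) (hs : ∀ U ∈ s, ∀ W ∈ s, U ≤ W ∨ W ≤ U) :
    ∃ γ : isomGroup F g, ∀ U ∈ s, γ • stdFlag F g (finrank F U) = U := by
  -- Induction on n: the members of dimension at most n are already matched, and the n-th step of
  -- the translated flag lies in all larger ones. The next vector is taken inside the smallest
  -- larger member.
  suffices H : ∀ n, ∃ γ : isomGroup F g, ∀ U ∈ s,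
      (finrank F U ≤ n → γ • stdFlag F g (finrank F U) = U) ∧
        (n < finrank F U → γ • stdFlag F g n ≤ U) by
    obtain ⟨γ, hγ⟩ := H g
    exact ⟨γ, fun U hU => (hγ U hU).1 (hiso U hU).finrank_le⟩
  intro n
  induction n with
  | zero =>
    refine ⟨1, fun U hU => ⟨fun h => ?_, fun _ => by simp [stdFlag_zero]⟩⟩
    have h0 : finrank F U = 0 := by omega
    rw [h0, stdFlag_zero, one_smul]
    exact (Submodule.finrank_eq_zero.1 h0).symm
  | succ n ih =>
    obtain ⟨γ₀, h₀⟩ := ih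
    by_cases hex : ∃ d, ∃ U ∈ s, n < finrank F U ∧ finrank F U = d
    · classical
      obtain ⟨U₀, hU₀, hn, hd⟩ := Nat.find_spec hex
      have hmin : ∀ U ∈ s, n < finrank F U → U₀ ≤ U := by
        intro U hU h
        rcases hs U₀ hU₀ U hU with h' | h'
        · exact h'
        · have h1 : Nat.find hex ≤ finrank F U := Nat.find_min' hex ⟨U, hU, h, rfl⟩
          rw [← hd] at h1
          exact (Submodule.eq_of_le_of_finrank_le h' h1).ge
      obtain ⟨γ, h1, h2⟩ := exists_extend_flag γ₀ (hiso U₀ hU₀) ((h₀ U₀ hU₀).2 hn) hn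
      refine ⟨γ, fun U hU => ⟨fun h => ?_, fun h => h2.trans (hmin U hU (by omega))⟩⟩
      rcases Nat.lt_or_ge n (finrank F U) with h3 | h3
      · have h4 : finrank F U = n + 1 := by omega
        refine Submodule.eq_of_le_of_finrank_le ?_ ?_
        · rw [h4]; exact h2.trans (hmin U hU h3)
        · rw [finrank_smul, finrank_stdFlag (hiso U hU).finrank_le]
      · rw [h1 _ h3]
        exact (h₀ U hU).1 h3
    · refine ⟨γ₀, fun U hU => ⟨fun h => (h₀ U hU).1 ?_, fun h => ?_⟩⟩
      · by_contra h3
        exact hex ⟨_, U, hU, by omega, rfl⟩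
      · exact (hex ⟨_, U, hU, by omega, rfl⟩).elim

end Action

/-! ### Random position of a translated flag: first moment and tail bound. -/

section Counting

variable {F : Type u} [Field F] {g : ℕ}

lemma smul_stdFlag_self_of_fix {γ : isomGroup F g} {n : ℕ}
    (h : ∀ i : Fin g, i.val < n → γ • stdVec F i = stdVec F i) :
    γ • stdFlag F g n = stdFlag F g n := by
  have := smul_stdFlag_congr (γ := γ) (δ := 1) (k := n) (by simpa using h)
  rwa [one_smul] at this

/-- The stabilizer of `stdFlag n` is transitive on the vectors orthogonal to it and outside it. -/
lemma exists_stabilizer_smul_eq {n : ℕ} (hn : n < g) {x y : Space F g}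
    (hx : x ∈ perp (stdFlag F g n)) (hnx : x ∉ stdFlag F g n)
    (hy : y ∈ perp (stdFlag F g n)) (hny : y ∉ stdFlag F g n) :
    ∃ σ : isomGroup F g, σ • stdFlag F g n = stdFlag F g n ∧ σ • x = y := by
  have key : ∀ z, z ∈ perp (stdFlag F g n) → z ∉ stdFlag F g n →
      ∃ σ : isomGroup F g, σ • stdFlag F g n = stdFlag F g n ∧ σ • stdVec F ⟨n, hn⟩ = z := by
    intro z hz hnz
    obtain ⟨σ, h1, h2⟩ := exists_extend_vector (1 : isomGroup F g) hn
      (by rwa [one_smul]) (by rwa [one_smul])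
    exact ⟨σ, smul_stdFlag_self_of_fix (by simpa using h1), h2⟩
  obtain ⟨a, ha, ha'⟩ := key x hx hnx
  obtain ⟨b, hb, hb'⟩ := key y hy hny
  refine ⟨b * a⁻¹, ?_, ?_⟩
  · have h3 : a⁻¹ • stdFlag F g n = stdFlag F g n := by
      conv_lhs => rw [← ha, inv_smul_smul]
    rw [mul_smul, h3, hb]
  · rw [mul_smul, ← ha', inv_smul_smul, hb']

variable [Finite F]

noncomputable instance : Fintype (isomGroup F g) := Fintype.ofFinite _

noncomputable local instance : Fintype (Space F g) := Fintype.ofFinite _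

open Classical in
lemma card_filter_mem (U : Submodule F (Space F g)) :
    (Finset.univ.filter (· ∈ U)).card = Nat.card F ^ finrank F U := by
  rw [← Module.natCard_eq_pow_finrank (K := F) (V := U), Nat.card_eq_fintype_card]
  exact (Fintype.card_subtype _).symm

open Classical in
lemma card_filter_mem_diff {U W : Submodule F (Space F g)} (h : U ≤ W) :
    (Finset.univ.filter fun x => x ∈ W ∧ x ∉ U).card + Nat.card F ^ finrank F U =
      Nat.card F ^ finrank F W := by
  rw [← card_filter_mem W, ← card_filter_mem U, add_comm, ← Finset.card_union_of_disjoint]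
  · congr 1
    ext x
    simp only [Finset.mem_union, Finset.mem_filter, Finset.mem_univ, true_and]
    constructor
    · rintro (h' | h')
      · exact h h'
      · exact h'.1
    · intro h'
      by_cases hx : x ∈ U
      · exact Or.inl hx
      · exact Or.inr ⟨h', hx⟩
  · rw [Finset.disjoint_left]
    intro x hx hx'
    exact (Finset.mem_filter.1 hx').2.2 (Finset.mem_filter.1 hx).2

variable (F g) in
open Classical in
/-- The stabilizer of `stdFlag n`, as a finite set. -/
noncomputable def flagStab (n : ℕ) : Finset (isomGroup F g) :=
  Finset.univ.filter fun σ => σ • stdFlag F g n = stdFlag F g n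

lemma mem_flagStab {n : ℕ} {σ : isomGroup F g} :
    σ ∈ flagStab F g n ↔ σ • stdFlag F g n = stdFlag F g n := by
  simp [flagStab]

lemma one_mem_flagStab (n : ℕ) : (1 : isomGroup F g) ∈ flagStab F g n := by
  simp [mem_flagStab]

lemma mul_mem_flagStab {n : ℕ} {σ τ : isomGroup F g} (hσ : σ ∈ flagStab F g n)
    (hτ : τ ∈ flagStab F g n) : σ * τ ∈ flagStab F g n := by
  rw [mem_flagStab] at *
  rw [mul_smul, hτ, hσ]

lemma inv_mem_flagStab {n : ℕ} {σ : isomGroup F g} (hσ : σ ∈ flagStab F g n) :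
    σ⁻¹ ∈ flagStab F g n := by
  rw [mem_flagStab] at *
  conv_lhs => rw [← hσ, inv_smul_smul]

lemma flagStab_zero : flagStab F g 0 = Finset.univ := by
  refine Finset.eq_univ_of_forall fun σ => mem_flagStab.2 ?_
  rw [stdFlag_zero, eq_bot_iff, smul_le_iff]
  intro x hx
  rw [(Submodule.mem_bot F).1 hx, smul_zero]
  exact zero_mem _

lemma smul_mem_stdFlag_iff {n : ℕ} {σ : isomGroup F g} (hσ : σ ∈ flagStab F g n) {x : Space F g} :
    σ • x ∈ stdFlag F g n ↔ x ∈ stdFlag F g n := by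
  rw [mem_flagStab] at hσ
  conv_lhs => rw [← hσ, mem_smul_iff, inv_smul_smul]

lemma smul_mem_perp_stdFlag_iff {n : ℕ} {σ : isomGroup F g} (hσ : σ ∈ flagStab F g n)
    {x : Space F g} : σ • x ∈ perp (stdFlag F g n) ↔ x ∈ perp (stdFlag F g n) := by
  rw [mem_flagStab] at hσ
  conv_lhs => rw [← hσ, ← smul_perp, mem_smul_iff, inv_smul_smul]

open Classical in
-- The stabilizer of the n-th step E is transitive on E^⊥ \ E, so the image of x is uniform there
-- and lies in A with probability |A \ E| / |E^⊥ \ E|. Proved by double counting.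
lemma card_flagStab_smul_mem {n : ℕ} (hn : n < g) {x : Space F g} (A : Submodule F (Space F g))
    (hx : x ∈ perp (stdFlag F g n)) (hnx : x ∉ stdFlag F g n) (hA : A ≤ perp (stdFlag F g n)) :
    ((flagStab F g n).filter fun σ => σ • x ∈ A).card *
        (Finset.univ.filter fun y => y ∈ perp (stdFlag F g n) ∧ y ∉ stdFlag F g n).card =
      (flagStab F g n).card * (Finset.univ.filter fun y => y ∈ A ∧ y ∉ stdFlag F g n).card := by
  set O : Finset (Space F g) :=
    Finset.univ.filter fun y => y ∈ perp (stdFlag F g n) ∧ y ∉ stdFlag F g n with hO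
  have hconst : ∀ y ∈ O, ((flagStab F g n).filter fun σ => σ • y ∈ A).card =
      ((flagStab F g n).filter fun σ => σ • x ∈ A).card := by
    intro y hy
    rw [hO, Finset.mem_filter] at hy
    obtain ⟨τ, hτ, rfl⟩ := exists_stabilizer_smul_eq hn hx hnx hy.2.1 hy.2.2
    rw [← mem_flagStab] at hτ
    refine Finset.card_bij (fun σ _ => σ * τ) ?_ ?_ ?_
    · intro σ hσ
      rw [Finset.mem_filter] at hσ ⊢
      exact ⟨mul_mem_flagStab hσ.1 hτ, by rw [mul_smul]; exact hσ.2⟩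
    · intro a _ b _ h
      exact mul_right_cancel h
    · intro σ hσ
      rw [Finset.mem_filter] at hσ
      refine ⟨σ * τ⁻¹, ?_, by group⟩
      rw [Finset.mem_filter]
      exact ⟨mul_mem_flagStab hσ.1 (inv_mem_flagStab hτ), by
        rw [mul_smul, inv_smul_smul]; exact hσ.2⟩
  have hdc : ∑ y ∈ O, ((flagStab F g n).filter fun σ => σ • y ∈ A).card =
      ∑ σ ∈ flagStab F g n, (O.filter fun y => σ • y ∈ A).card :=
    Finset.sum_card_bipartiteAbove_eq_sum_card_bipartiteBelow (fun y σ => σ • y ∈ A)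
  have hfib : ∀ σ ∈ flagStab F g n, (O.filter fun y => σ • y ∈ A).card =
      (Finset.univ.filter fun y => y ∈ A ∧ y ∉ stdFlag F g n).card := by
    intro σ hσ
    refine Finset.card_bij (fun y _ => σ • y) ?_ ?_ ?_
    · intro y hy
      simp only [hO, Finset.mem_filter, Finset.mem_univ, true_and] at hy ⊢
      exact ⟨hy.2, by rw [smul_mem_stdFlag_iff hσ]; exact hy.1.2⟩
    · intro a _ b _ h
      exact smul_left_cancel σ h
    · intro y hy
      simp only [Finset.mem_filter, Finset.mem_univ, true_and] at hy
      refine ⟨σ⁻¹ • y, ?_, smul_inv_smul _ _⟩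
      simp only [hO, Finset.mem_filter, Finset.mem_univ, true_and, smul_inv_smul]
      have hσ' := inv_mem_flagStab hσ
      rw [smul_mem_perp_stdFlag_iff hσ', smul_mem_stdFlag_iff hσ']
      exact ⟨⟨hA hy.1, hy.2⟩, hy.1⟩
  rw [Finset.sum_congr rfl hconst, Finset.sum_congr rfl hfib, Finset.sum_const, Finset.sum_const,
    smul_eq_mul, smul_eq_mul] at hdc
  rw [mul_comm, hdc]

open Classical in
-- First moment of the number of vectors in the intersection: the vectors of the fixed part
-- contribute at most q^n, and by uniformity all others together contribute at most q^n on average.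
lemma sum_card_smul_stdFlag_inf_perp_le {n a b : ℕ} (hnb : n ≤ b) (hba : b ≤ a) (ha : a ≤ g) :
    ∑ σ ∈ flagStab F g n, Nat.card F ^ finrank F ↑(σ • stdFlag F g b ⊓ perp (stdFlag F g a)) ≤
      2 * Nat.card F ^ n * (flagStab F g n).card := by
  set q := Nat.card F with hq
  have hq1 : 1 ≤ q := Nat.one_le_iff_ne_zero.2 Nat.card_pos.ne'
  set S := flagStab F g n with hS
  set A := perp (stdFlag F g a) with hA
  have hAn : A ≤ perp (stdFlag F g n) :=
    LinearMap.BilinForm.orthogonal_le (stdFlag_mono (hnb.trans hba))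
  have hEA : stdFlag F g n ≤ A := (stdFlag_mono (hnb.trans hba)).trans
    (isIsotropic_iff_le_perp.1 (isIsotropic_stdFlag a))
  have hbp : stdFlag F g b ≤ perp (stdFlag F g n) :=
    (isIsotropic_iff_le_perp.1 (isIsotropic_stdFlag b)).trans
      (LinearMap.BilinForm.orthogonal_le (stdFlag_mono hnb))
  have hfin : ∀ k ≤ g, finrank F (stdFlag F g k) = k := fun k hk => finrank_stdFlag hk
  have hle : ∑ σ ∈ S, q ^ finrank F ↑(σ • stdFlag F g b ⊓ A) =
      ∑ x ∈ Finset.univ.filter (· ∈ stdFlag F g b), (S.filter fun σ => σ • x ∈ A).card := by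
    rw [show (∑ x ∈ Finset.univ.filter (· ∈ stdFlag F g b), (S.filter fun σ => σ • x ∈ A).card) =
      ∑ σ ∈ S, ((Finset.univ.filter (· ∈ stdFlag F g b)).filter fun x => σ • x ∈ A).card from
      Finset.sum_card_bipartiteAbove_eq_sum_card_bipartiteBelow (fun x σ => σ • x ∈ A)]
    refine Finset.sum_congr rfl fun σ _ => ?_
    rw [hq, ← card_filter_mem]
    refine Finset.card_bij (fun y _ => σ⁻¹ • y) ?_ ?_ ?_
    · intro y hy
      simp only [Finset.mem_filter, Finset.mem_univ, true_and, Submodule.mem_inf,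
        mem_smul_iff] at hy ⊢
      exact ⟨hy.1, by rw [smul_inv_smul]; exact hy.2⟩
    · intro a _ b _ h
      exact smul_left_cancel _ h
    · intro y hy
      simp only [Finset.mem_filter, Finset.mem_univ, true_and] at hy
      refine ⟨σ • y, ?_, inv_smul_smul _ _⟩
      simp only [Finset.mem_filter, Finset.mem_univ, true_and, Submodule.mem_inf, mem_smul_iff,
        inv_smul_smul]
      exact hy
  rw [hle]
  have hsplit := Finset.sum_filter_add_sum_filter_not (Finset.univ.filter (· ∈ stdFlag F g b))
    (· ∈ stdFlag F g n) (fun x => (S.filter fun σ => σ • x ∈ A).card)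
  rw [← hsplit]
  have h1 : ∑ x ∈ (Finset.univ.filter (· ∈ stdFlag F g b)).filter (· ∈ stdFlag F g n),
      (S.filter fun σ => σ • x ∈ A).card ≤ q ^ n * S.card := by
    refine (Finset.sum_le_card_nsmul _ _ S.card fun x _ => Finset.card_filter_le _ _).trans ?_
    rw [smul_eq_mul]
    refine Nat.mul_le_mul_right _ ?_
    have h2 := card_filter_mem (stdFlag F g n)
    rw [hfin n (by omega), ← hq] at h2
    rw [← h2]
    refine Finset.card_le_card fun x hx => ?_
    rw [Finset.mem_filter] at hx ⊢
    exact ⟨Finset.mem_univ _, hx.2⟩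
  have h2 : ∑ x ∈ (Finset.univ.filter (· ∈ stdFlag F g b)).filter (¬ · ∈ stdFlag F g n),
      (S.filter fun σ => σ • x ∈ A).card ≤ q ^ n * S.card := by
    rcases hnb.eq_or_lt with rfl | hlt
    · rw [Finset.sum_eq_zero]
      · exact Nat.zero_le _
      · intro x hx
        simp only [Finset.mem_filter, Finset.mem_univ, true_and] at hx
        exact (hx.2 hx.1).elim
    have hng : n < g := by omega
    set O : Finset (Space F g) :=
      Finset.univ.filter fun y => y ∈ perp (stdFlag F g n) ∧ y ∉ stdFlag F g n with hO
    have hOc := card_filter_mem_diff ((isIsotropic_iff_le_perp.1 (isIsotropic_stdFlag (F := F) (g := g) n)))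
    have hAc := card_filter_mem_diff hEA
    have hBc := card_filter_mem_diff (stdFlag_mono (F := F) (g := g) hnb)
    rw [← hO, finrank_perp, hfin n (by omega), ← hq] at hOc
    rw [hA, finrank_perp, hfin n (by omega), hfin a ha, ← hq, ← hA] at hAc
    rw [hfin n (by omega), hfin b (by omega), ← hq] at hBc
    set cA := (Finset.univ.filter fun y => y ∈ A ∧ y ∉ stdFlag F g n).card with hcA
    set cB := (Finset.univ.filter fun y => y ∈ stdFlag F g b ∧ y ∉ stdFlag F g n).card with hcB
    have hsum : (∑ x ∈ (Finset.univ.filter (· ∈ stdFlag F g b)).filter (¬ · ∈ stdFlag F g n),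
        (S.filter fun σ => σ • x ∈ A).card) * O.card = cB * (S.card * cA) := by
      rw [Finset.sum_mul, hcB, ← smul_eq_mul (Finset.card _), ← Finset.sum_const,
        Finset.filter_filter]
      refine Finset.sum_congr rfl fun x hx => ?_
      rw [Finset.mem_filter] at hx
      exact card_flagStab_smul_mem hng A (hbp hx.2.1) hx.2.2 hAn
    have hOpos : 0 < O.card := by
      have : q ^ n < q ^ (2 * g - n) :=
        Nat.pow_lt_pow_right (Finite.one_lt_card) (by omega)
      omega
    -- This is (q^b - q^n)(q^(2g-a) - q^n) ≤ q^n (q^(2g-n) - q^n); after expansion it only needs b ≤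
    -- a.
    have hmain : cB * cA ≤ q ^ n * O.card := by
      have e1 : q ^ b * q ^ (2 * g - a) ≤ q ^ n * q ^ (2 * g - n) := by
        rw [← pow_add, ← pow_add]
        exact Nat.pow_le_pow_right hq1 (by omega)
      have e2 : cB * cA + q ^ n * cA + q ^ n * cB + q ^ n * q ^ n = q ^ b * q ^ (2 * g - a) := by
        rw [← hBc, ← hAc]; ring
      have e3 : q ^ n * O.card + q ^ n * q ^ n = q ^ n * q ^ (2 * g - n) := by
        rw [← hOc]; ring
      have e4 : 0 ≤ q ^ n * cA := Nat.zero_le _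
      have e5 : 0 ≤ q ^ n * cB := Nat.zero_le _
      omega
    refine Nat.le_of_mul_le_mul_right ?_ hOpos
    rw [hsum]
    calc cB * (S.card * cA) = (cB * cA) * S.card := by ring
      _ ≤ (q ^ n * O.card) * S.card := Nat.mul_le_mul_right _ hmain
      _ = _ := by ring
  calc _ ≤ q ^ n * S.card + q ^ n * S.card := Nat.add_le_add h1 h2
    _ = _ := by ring

open Classical in
/-- A random translate of `stdFlag b` over `stdFlag n` rarely meets the orthogonal complement of
`stdFlag a` in more than the expected dimension. -/
lemma card_finrank_inf_perp_tail {n a b : ℕ} (hnb : n ≤ b) (hba : b ≤ a) (ha : a ≤ g) (r : ℕ) :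
    (((flagStab F g n).filter fun σ =>
        r ≤ finrank F ↑(σ • stdFlag F g b ⊓ perp (stdFlag F g a)) - n).card : ℝ) ≤
      2 * (1 / 2) ^ r * (flagStab F g n).card := by
  set q := Nat.card F with hq
  have hq2 : 2 ≤ q := Finite.one_lt_card
  -- For r = 0 the truncated subtraction gives no lower bound on the dimension, but the claim is
  -- trivial. For r > 0 it is Markov's inequality.
  rcases Nat.eq_zero_or_pos r with rfl | hr
  · have h1 := Finset.card_filter_le (flagStab F g n) fun σ =>
      0 ≤ finrank F ↑(σ • stdFlag F g b ⊓ perp (stdFlag F g a)) - n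
    have h2 : (0 : ℝ) ≤ (flagStab F g n).card := Nat.cast_nonneg _
    rw [pow_zero, mul_one]
    have h3 : ((Finset.card _ : ℕ) : ℝ) ≤ _ := Nat.cast_le.2 h1
    linarith
  set P := (flagStab F g n).filter fun σ =>
    r ≤ finrank F ↑(σ • stdFlag F g b ⊓ perp (stdFlag F g a)) - n with hP
  have h1 : P.card * q ^ (n + r) ≤ 2 * q ^ n * (flagStab F g n).card := by
    refine le_trans ?_ (sum_card_smul_stdFlag_inf_perp_le hnb hba ha)
    refine le_trans ?_ (Finset.sum_le_sum_of_subset (Finset.filter_subset _ _ : P ⊆ _))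
    rw [← smul_eq_mul, ← Finset.sum_const]
    refine Finset.sum_le_sum fun σ hσ => ?_
    refine Nat.pow_le_pow_right (by omega) ?_
    have := (Finset.mem_filter.1 hσ).2
    omega
  -- Weakening q to 2 makes the tail independent of the field.
  have h2 : P.card * 2 ^ r ≤ 2 * (flagStab F g n).card := by
    have h3 : P.card * q ^ r ≤ 2 * (flagStab F g n).card := by
      refine Nat.le_of_mul_le_mul_right (c := q ^ n) ?_ (by positivity)
      calc _ = P.card * q ^ (n + r) := by rw [pow_add]; ring
        _ ≤ _ := h1
        _ = _ := by ring
    exact (Nat.mul_le_mul_left _ (Nat.pow_le_pow_left hq2 r)).trans h3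
  have h3 : (P.card : ℝ) * 2 ^ r ≤ 2 * (flagStab F g n).card := by exact_mod_cast h2
  rw [one_div, inv_pow, mul_right_comm, ← div_eq_mul_inv, le_div_iff₀ (by positivity)]
  exact h3

end Counting

/-! ### Averaging a weight over random types. -/

section Density

/-- The constant bounding the density of the fillings. -/
noncomputable def tailConst : ℝ := ∑' r : ℕ, ((r : ℝ) + 1) ^ 3 * (2 * (1 / 2) ^ r)

lemma summable_tailConst : Summable fun r : ℕ => ((r : ℝ) + 1) ^ 3 * (2 * (1 / 2 : ℝ) ^ r) := by
  have h := (summable_nat_add_iff 1).2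
    (summable_pow_mul_geometric_of_norm_lt_one (R := ℝ) 3 (r := 1 / 2) (by norm_num))
  refine (h.mul_left 4).congr fun r => ?_
  push_cast
  rw [pow_succ]
  ring

lemma tailConst_nonneg : 0 ≤ tailConst := tsum_nonneg fun r => by positivity

lemma sum_range_le_tailConst (N : ℕ) :
    ∑ r ∈ Finset.range N, ((r : ℝ) + 1) ^ 3 * (2 * (1 / 2 : ℝ) ^ r) ≤ tailConst :=
  summable_tailConst.sum_le_tsum _ fun r _ => by positivity

open Classical in
/-- Averages of `β` over random types are bounded by the total mass of `β`, if the type depends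
injectively on the index for every fixed deviation and the deviations have geometric tails. -/
lemma sum_le_tailConst_mul {ι τ G : Type*} (I : Finset ι) (Ω : Finset G) (R : ι → G → ℕ)
    (D : ι → G → ℕ × ℕ × ℕ)
    (hD : ∀ x ∈ I, ∀ σ ∈ Ω, (D x σ).1 ≤ R x σ ∧ (D x σ).2.1 ≤ R x σ ∧ (D x σ).2.2 ≤ R x σ)
    (htail : ∀ x ∈ I, ∀ r, ((Ω.filter fun σ => r ≤ R x σ).card : ℝ) ≤ 2 * (1 / 2) ^ r * Ω.card)
    (T : ι → ℕ → ℕ × ℕ × ℕ → τ) (hT : ∀ r d, Set.InjOn (fun x => T x r d) I)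
    (β : τ → ℝ) (hβ : ∀ t, 0 ≤ β t) (B : ℝ) (hB : ∀ A : Finset τ, ∑ t ∈ A, β t ≤ B) :
    ∑ x ∈ I, ∑ σ ∈ Ω, β (T x (R x σ) (D x σ)) ≤ tailConst * B * Ω.card := by
  obtain ⟨N, hN⟩ : ∃ N, ∀ x ∈ I, ∀ σ ∈ Ω, R x σ < N := by
    refine ⟨(I ×ˢ Ω).sup (fun p => R p.1 p.2) + 1, fun x hx σ hσ => Nat.lt_succ_of_le ?_⟩
    exact Finset.le_sup (f := fun p : ι × G => R p.1 p.2) (Finset.mk_mem_product hx hσ)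
  let Q : ℕ → Finset (ℕ × ℕ × ℕ) := fun r =>
    Finset.range (r + 1) ×ˢ Finset.range (r + 1) ×ˢ Finset.range (r + 1)
  have hQ : ∀ r, (Q r).card = (r + 1) ^ 3 := fun r => by simp [Q]; ring
  have hB0 : 0 ≤ B := by simpa using hB ∅
  have hpoint : ∀ x ∈ I, ∑ σ ∈ Ω, β (T x (R x σ) (D x σ)) ≤
      ∑ r ∈ Finset.range N, ∑ d ∈ Q r, 2 * (1 / 2) ^ r * Ω.card * β (T x r d) := by
    intro x hx
    calc ∑ σ ∈ Ω, β (T x (R x σ) (D x σ))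
        = ∑ σ ∈ Ω, ∑ r ∈ Finset.range N, ∑ d ∈ Q r,
          if R x σ = r ∧ D x σ = d then β (T x r d) else 0 := by
          refine Finset.sum_congr rfl fun σ hσ => ?_
          rw [Finset.sum_eq_single_of_mem (R x σ) (Finset.mem_range.2 (hN x hx σ hσ)),
            Finset.sum_eq_single_of_mem (D x σ)]
          · simp
          · obtain ⟨h1, h2, h3⟩ := hD x hx σ hσ
            simp only [Q, Finset.mem_product, Finset.mem_range]
            omega
          · intro d _ hd
            rw [if_neg fun h => hd h.2.symm]
          · intro r _ hr
            exact Finset.sum_eq_zero fun d _ => if_neg fun h => hr h.1.symm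
      _ = ∑ r ∈ Finset.range N, ∑ d ∈ Q r, ∑ σ ∈ Ω,
          if R x σ = r ∧ D x σ = d then β (T x r d) else 0 := by
          rw [Finset.sum_comm]
          exact Finset.sum_congr rfl fun r _ => Finset.sum_comm
      _ ≤ _ := by
          refine Finset.sum_le_sum fun r _ => Finset.sum_le_sum fun d _ => ?_
          -- The event that the deviation is exactly (r, d) is bounded by the tail event for r
          -- alone; the (r + 1)³ possible d account for the cubic factor in `tailConst`.
          rw [← Finset.sum_filter, Finset.sum_const, nsmul_eq_mul]
          refine mul_le_mul_of_nonneg_right (le_trans ?_ (htail x hx r)) (hβ _)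
          refine Nat.cast_le.2 (Finset.card_le_card fun σ hσ => ?_)
          rw [Finset.mem_filter] at hσ ⊢
          exact ⟨hσ.1, hσ.2.1.ge⟩
  calc _ ≤ ∑ x ∈ I, ∑ r ∈ Finset.range N, ∑ d ∈ Q r, 2 * (1 / 2) ^ r * Ω.card * β (T x r d) :=
        Finset.sum_le_sum hpoint
    _ = ∑ r ∈ Finset.range N, ∑ d ∈ Q r, 2 * (1 / 2) ^ r * Ω.card * ∑ x ∈ I, β (T x r d) := by
        rw [Finset.sum_comm]
        refine Finset.sum_congr rfl fun r _ => ?_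
        rw [Finset.sum_comm]
        refine Finset.sum_congr rfl fun d _ => ?_
        rw [Finset.mul_sum]
    _ ≤ ∑ r ∈ Finset.range N, ∑ d ∈ Q r, 2 * (1 / 2) ^ r * Ω.card * B := by
        refine Finset.sum_le_sum fun r _ => Finset.sum_le_sum fun d _ => ?_
        refine mul_le_mul_of_nonneg_left ?_ (by positivity)
        -- For a fixed deviation distinct indices give distinct types, so the sum is part of the
        -- total mass.
        rw [← Finset.sum_image (hT r d)]
        exact hB _
    _ = (∑ r ∈ Finset.range N, ((r : ℝ) + 1) ^ 3 * (2 * (1 / 2 : ℝ) ^ r)) * (B * Ω.card) := by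
        rw [Finset.sum_mul]
        refine Finset.sum_congr rfl fun r _ => ?_
        rw [Finset.sum_const, hQ, nsmul_eq_mul]
        push_cast
        ring
    _ ≤ tailConst * (B * Ω.card) :=
        mul_le_mul_of_nonneg_right (sum_range_le_tailConst N) (by positivity)
    _ = _ := by ring

end Density

/-! ### The hinge path between two isotropic subspaces. -/

section Hinge

variable {F : Type u} [Field F] {g : ℕ}

/-- The part of `U` orthogonal to `W`. -/
abbrev mid (U W : Submodule F (Space F g)) : Submodule F (Space F g) := U ⊓ perp W

/-- The join of `W` with the part of `U` orthogonal to it. -/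
abbrev hinge (U W : Submodule F (Space F g)) : Submodule F (Space F g) := mid U W ⊔ W

lemma smul_sup_eq (γ : isomGroup F g) (U W : Submodule F (Space F g)) :
    γ • (U ⊔ W) = γ • U ⊔ γ • W :=
  Submodule.map_sup U W (γ.1 : Space F g →ₗ[F] Space F g)

lemma smul_mid (γ : isomGroup F g) (U W : Submodule F (Space F g)) :
    γ • mid U W = mid (γ • U) (γ • W) := by
  rw [smul_inf_eq, smul_perp]

lemma smul_hinge (γ : isomGroup F g) (U W : Submodule F (Space F g)) :
    γ • hinge U W = hinge (γ • U) (γ • W) := by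
  rw [smul_sup_eq, smul_mid]

lemma finrank_mid {U W : Submodule F (Space F g)} (h : finrank F W ≤ finrank F U) :
    finrank F (mid U W) = finrank F U - finrank F W + finrank F ↑(W ⊓ perp U) := by
  have h1 : finrank F (mid U W) + finrank F W = finrank F U + finrank F ↑(W ⊓ perp U) :=
    finrank_inf_perp U W
  omega

lemma finrank_inf_le {U W : Submodule F (Space F g)} (hU : IsIsotropic F g U) :
    finrank F ↑(U ⊓ W) ≤ finrank F ↑(W ⊓ perp U) := by
  apply Submodule.finrank_mono
  rw [inf_comm]
  exact inf_le_inf_left _ (isIsotropic_iff_le_perp.1 hU)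

/-- Since W is isotropic, `mid U W` meets W exactly in U ∩ W. So the hinge has the dimension of U,
up to an excess bounded by dim (W ∩ U^⊥). -/
lemma finrank_hinge {U W : Submodule F (Space F g)} (hU : IsIsotropic F g U)
    (hW : IsIsotropic F g W) :
    finrank F (hinge U W) = finrank F U + (finrank F ↑(W ⊓ perp U) - finrank F ↑(U ⊓ W)) := by
  have h1 := Submodule.finrank_sup_add_finrank_inf_eq (mid U W) W
  have h2 : mid U W ⊓ W = U ⊓ W := by
    rw [inf_assoc, inf_eq_right.2 (isIsotropic_iff_le_perp.1 hW)]
  rw [h2] at h1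
  have h3 : finrank F (mid U W) + finrank F W = finrank F U + finrank F ↑(W ⊓ perp U) :=
    finrank_inf_perp U W
  have h5 : finrank F (hinge U W) + finrank F ↑(U ⊓ W) = finrank F (mid U W) + finrank F W := h1
  have h4 := finrank_inf_le (W := W) hU
  omega

lemma isIsotropic_hinge {U W : Submodule F (Space F g)} (hU : IsIsotropic F g U)
    (hW : IsIsotropic F g W) : IsIsotropic F g (hinge U W) :=
  isIsotropic_sup (hU.mono inf_le_left) hW inf_le_right

lemma ne_bot_of_finrank_pos {U : Submodule F (Space F g)} (h : 1 ≤ finrank F U) : U ≠ ⊥ := by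
  rintro rfl
  simp at h

end Hinge

/-! ### Weights of violated triangles and edges by dimension type. -/

section Weights

open Classical in
/-- The indicator of a proposition. -/
noncomputable def ind (P : Prop) : ℝ := if P then 1 else 0

lemma ind_nonneg (P : Prop) : 0 ≤ ind P := by
  unfold ind; split_ifs <;> norm_num

lemma ind_true {P : Prop} (h : P) : ind P = 1 := if_pos h

lemma ind_false {P : Prop} (h : ¬P) : ind P = 0 := if_neg h

lemma ind_le_one (P : Prop) : ind P ≤ 1 := by
  unfold ind; split_ifs <;> norm_num

lemma ind_mono {P Q : Prop} (h : P → Q) : ind P ≤ ind Q := by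
  by_cases hP : P
  · rw [ind_true hP, ind_true (h hP)]
  · rw [ind_false hP]; exact ind_nonneg _

lemma ind_or_le (P Q : Prop) : ind (P ∨ Q) ≤ ind P + ind Q := by
  by_cases hP : P
  · rw [ind_true hP]
    have := ind_le_one (P ∨ Q)
    have := ind_nonneg Q
    linarith
  · have : ind (P ∨ Q) ≤ ind Q := ind_mono fun h => h.resolve_left hP
    have := ind_nonneg P
    linarith

variable {F : Type u} [Field F] {g : ℕ} {Γ : Type w} [Group Γ]

/-- The cocycle condition fails on `(U, V, W)`. -/
def BadTri (φ : Submodule F (Space F g) → Submodule F (Space F g) → Γ)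
    (U V W : Submodule F (Space F g)) : Prop := φ U V * φ V W ≠ φ U W

/-- `φ` differs from the coboundary of `h` on `(U, V)`. -/
def BadEdge (φ : Submodule F (Space F g) → Submodule F (Space F g) → Γ)
    (h : Submodule F (Space F g) → Γ) (U V : Submodule F (Space F g)) : Prop :=
  φ U V ≠ h U * (h V)⁻¹

variable [Finite F]

/-- The chain is a translate by some δ of members of the standard flag, and γ ↦ γδ permutes the
group; the count depends on the dimensions only. -/
lemma sum_ind_smul_chain (P : Submodule F (Space F g) → Submodule F (Space F g) →
    Submodule F (Space F g) → Prop) {U V W : Submodule F (Space F g)} (hW : IsIsotropic F g W)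
    (hUV : U ≤ V) (hVW : V ≤ W) :
    ∑ γ : isomGroup F g, ind (P (γ • U) (γ • V) (γ • W)) =
      ∑ γ : isomGroup F g, ind (P (γ • stdFlag F g (finrank F U)) (γ • stdFlag F g (finrank F V))
        (γ • stdFlag F g (finrank F W))) := by
  obtain ⟨δ, hδ⟩ := exists_smul_stdFlag_eq {U, V, W}
    (by
      rintro X (rfl | rfl | rfl)
      exacts [hW.mono (hUV.trans hVW), hW.mono hVW, hW])
    (by
      rintro X (rfl | rfl | rfl) Y (rfl | rfl | rfl)
      all_goals first
        | exact Or.inl le_rfl | exact Or.inl hUV | exact Or.inr hUV | exact Or.inl hVW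
        | exact Or.inr hVW | exact Or.inl (hUV.trans hVW) | exact Or.inr (hUV.trans hVW))
  rw [← Equiv.sum_comp (Equiv.mulRight δ) fun γ : isomGroup F g =>
    ind (P (γ • stdFlag F g (finrank F U)) (γ • stdFlag F g (finrank F V))
        (γ • stdFlag F g (finrank F W)))]
  refine Finset.sum_congr rfl fun γ _ => ?_
  simp only [Equiv.coe_mulRight, mul_smul]
  rw [hδ U (by simp), hδ V (by simp), hδ W (by simp)]

/-- The number of isometries carrying the standard triangle of type `(a, b, c)` to one on which the
cocycle condition fails. -/
noncomputable def triWeight (φ : Submodule F (Space F g) → Submodule F (Space F g) → Γ)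
    (t : ℕ × ℕ × ℕ) : ℝ :=
  if 1 ≤ t.1 ∧ t.1 ≤ t.2.1 ∧ t.2.1 ≤ t.2.2 ∧ t.2.2 ≤ g then
    ∑ γ : isomGroup F g,
      ind (BadTri φ (γ • stdFlag F g t.1) (γ • stdFlag F g t.2.1) (γ • stdFlag F g t.2.2))
  else 0

/-- The total weight of the triangles on which the cocycle condition fails. -/
noncomputable def triTotal (φ : Submodule F (Space F g) → Submodule F (Space F g) → Γ) : ℝ :=
  ∑ t ∈ Finset.Icc 1 g ×ˢ Finset.Icc 1 g ×ˢ Finset.Icc 1 g, triWeight φ t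

/-- The number of isometries carrying the standard edge of type `(a, b)` to one on which `φ` is not
the coboundary of `h`. -/
noncomputable def edgeWeight (φ : Submodule F (Space F g) → Submodule F (Space F g) → Γ)
    (h : Submodule F (Space F g) → Γ) (a b : ℕ) : ℝ :=
  ∑ γ : isomGroup F g, ind (BadEdge φ h (γ • stdFlag F g a) (γ • stdFlag F g b))

variable {φ : Submodule F (Space F g) → Submodule F (Space F g) → Γ}

lemma triWeight_nonneg (t : ℕ × ℕ × ℕ) : 0 ≤ triWeight φ t := by
  unfold triWeight
  split_ifs
  · exact Finset.sum_nonneg fun _ _ => ind_nonneg _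
  · exact le_rfl

lemma edgeWeight_nonneg (h : Submodule F (Space F g) → Γ) (a b : ℕ) : 0 ≤ edgeWeight φ h a b :=
  Finset.sum_nonneg fun _ _ => ind_nonneg _

lemma sum_le_sum_of_support {τ : Type*} {β : τ → ℝ} (hβ : ∀ t, 0 ≤ β t) {S : Finset τ}
    (hS : ∀ t, β t ≠ 0 → t ∈ S) (A : Finset τ) : ∑ t ∈ A, β t ≤ ∑ t ∈ S, β t := by
  classical
  rw [← Finset.sum_filter_ne_zero]
  refine Finset.sum_le_sum_of_subset_of_nonneg (fun t ht => hS t (Finset.mem_filter.1 ht).2)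
    fun t _ _ => hβ t

lemma triWeight_support (t : ℕ × ℕ × ℕ) (h : triWeight φ t ≠ 0) :
    t ∈ Finset.Icc 1 g ×ˢ Finset.Icc 1 g ×ˢ Finset.Icc 1 g := by
  unfold triWeight at h
  split_ifs at h with h'
  · simp only [Finset.mem_product, Finset.mem_Icc]
    omega
  · exact (h rfl).elim

lemma sum_triWeight_le (A : Finset (ℕ × ℕ × ℕ)) : ∑ t ∈ A, triWeight φ t ≤ triTotal φ :=
  sum_le_sum_of_support triWeight_nonneg triWeight_support A

lemma sum_ind_badTri {U V W : Submodule F (Space F g)} (hW : IsIsotropic F g W)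
    (hUV : U ≤ V) (hVW : V ≤ W) {a b c : ℕ} (ha : finrank F U = a) (hb : finrank F V = b)
    (hc : finrank F W = c) (hpos : 1 ≤ a) :
    ∑ γ : isomGroup F g, ind (BadTri φ (γ • U) (γ • V) (γ • W)) = triWeight φ (a, b, c) := by
  subst ha hb hc
  rw [sum_ind_smul_chain (BadTri φ) hW hUV hVW, triWeight, if_pos]
  exact ⟨hpos, Submodule.finrank_mono hUV, Submodule.finrank_mono hVW, hW.finrank_le⟩

lemma sum_ind_badEdge {h : Submodule F (Space F g) → Γ} {U V : Submodule F (Space F g)}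
    (hV : IsIsotropic F g V) (hUV : U ≤ V) {a b : ℕ} (ha : finrank F U = a)
    (hb : finrank F V = b) :
    ∑ γ : isomGroup F g, ind (BadEdge φ h (γ • U) (γ • V)) = edgeWeight φ h a b := by
  subst ha hb
  exact sum_ind_smul_chain (fun X Y _ => BadEdge φ h X Y) hV hUV le_rfl

end Weights

/-! ### Coning an edge from an apex. -/

section Cone

variable {F : Type u} [Field F] {g : ℕ} {Γ : Type w} [Group Γ]
  {φ : Submodule F (Space F g) → Submodule F (Space F g) → Γ}

/-- The product of `φ` along the path from `v` to `w` through their hinge. -/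
def coneFn (φ : Submodule F (Space F g) → Submodule F (Space F g) → Γ)
    (w v : Submodule F (Space F g)) : Γ :=
  φ v (mid v w) * φ (mid v w) (hinge v w) * φ (hinge v w) w

/-- The ladder formed by the two hinge paths over the edge is cut into one triangle at the apex w,
two between the rungs `hinge` and `mid`, and two between `mid` and the edge. If all five satisfy the
cocycle condition, the products along the paths telescope. -/
lemma ind_badEdge_coneFn_le (hφ : ∀ U V, φ U V = (φ V U)⁻¹) (w v v' : Submodule F (Space F g)) :
    ind (BadEdge φ (coneFn φ w) v v') ≤
      ind (BadTri φ w (hinge v w) (hinge v' w)) +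
      ind (BadTri φ (mid v w) (hinge v w) (hinge v' w)) +
      ind (BadTri φ (mid v w) (mid v' w) (hinge v' w)) +
      ind (BadTri φ (mid v w) (mid v' w) v') +
      ind (BadTri φ (mid v w) v v') := by
  have h : BadEdge φ (coneFn φ w) v v' → (((BadTri φ w (hinge v w) (hinge v' w) ∨
      BadTri φ (mid v w) (hinge v w) (hinge v' w)) ∨
      BadTri φ (mid v w) (mid v' w) (hinge v' w)) ∨
      BadTri φ (mid v w) (mid v' w) v') ∨
      BadTri φ (mid v w) v v' := by
    intro hbad
    by_contra hcon
    simp only [not_or, BadTri, not_not] at hcon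
    obtain ⟨⟨⟨⟨h1, h2⟩, h3⟩, h4⟩, h5⟩ := hcon
    refine hbad ?_
    rw [coneFn, coneFn, hφ v (mid v w), hφ (hinge v w) w, hφ v' (mid v' w), hφ (hinge v' w) w]
    generalize φ (mid v w) v = a, φ (mid v w) (hinge v w) = b, φ w (hinge v w) = c,
      φ w (hinge v' w) = c', φ (hinge v w) (hinge v' w) = d, φ (mid v w) (hinge v' w) = e,
      φ (mid v w) (mid v' w) = p, φ (mid v' w) (hinge v' w) = q, φ (mid v' w) v' = k,
      φ (mid v w) v' = l, φ v v' = x at *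
    subst h1 h2 h4
    obtain rfl := eq_mul_inv_of_mul_eq h3
    obtain rfl := eq_inv_mul_of_mul_eq h5
    group
  refine (ind_mono h).trans ((ind_or_le _ _).trans (add_le_add_left ?_ _))
  refine (ind_or_le _ _).trans (add_le_add_left ?_ _)
  refine (ind_or_le _ _).trans (add_le_add_left ?_ _)
  exact ind_or_le _ _

end Cone

/-! ### Edges between dimensions above m. -/

section High

variable {F : Type u} [Field F] [Finite F] {g : ℕ} {Γ : Type w} [Group Γ]
  {φ : Submodule F (Space F g) → Submodule F (Space F g) → Γ}

/-- The pairs of dimensions `m < a ≤ b ≤ g`. -/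
def highPairs (g m : ℕ) : Finset (ℕ × ℕ) :=
  (Finset.Icc (m + 1) g ×ˢ Finset.Icc (m + 1) g).filter fun p => p.1 ≤ p.2

lemma mem_highPairs {g m : ℕ} {p : ℕ × ℕ} :
    p ∈ highPairs g m ↔ m < p.1 ∧ p.1 ≤ p.2 ∧ p.2 ≤ g := by
  simp only [highPairs, Finset.mem_filter, Finset.mem_product, Finset.mem_Icc]
  omega

/-- The total weight of the high-dimensional edges on which `φ` is not the coboundary of `h`. -/
noncomputable def highTotal (φ : Submodule F (Space F g) → Submodule F (Space F g) → Γ)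
    (h : Submodule F (Space F g) → Γ) (m : ℕ) : ℝ :=
  ∑ p ∈ highPairs g m, edgeWeight φ h p.1 p.2

/-- Common bound for one of the five families of filling triangles. The edge is standard and the
apex w is random; R is dim (w ∩ u^⊥), and D records dim (w ∩ u'^⊥) and the excess dimensions of the
two hinges. -/
lemma sum_cone_triangle_le {m : ℕ}
    (A₁ A₂ A₃ : Submodule F (Space F g) → Submodule F (Space F g) → Submodule F (Space F g) →
      Submodule F (Space F g))
    (T : (ℕ × ℕ) × ℕ → ℕ → ℕ × ℕ × ℕ → ℕ × ℕ × ℕ)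
    (hT : ∀ r d, Set.InjOn (fun x => T x r d) ↑(highPairs g m ×ˢ Finset.Icc 1 m))
    (hA : ∀ x ∈ highPairs g m ×ˢ Finset.Icc 1 m, ∀ σ : isomGroup F g,
      ∀ u u' w, u = stdFlag F g x.1.1 → u' = stdFlag F g x.1.2 → w = σ • stdFlag F g x.2 →
      A₁ u u' w ≤ A₂ u u' w ∧ A₂ u u' w ≤ A₃ u u' w ∧ IsIsotropic F g (A₃ u u' w) ∧ 1 ≤ finrank F (A₁ u u' w) ∧
      (finrank F (A₁ u u' w), finrank F (A₂ u u' w), finrank F (A₃ u u' w)) =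
        T x (finrank F ↑(w ⊓ perp u)) (finrank F ↑(w ⊓ perp u'),
          finrank F ↑(w ⊓ perp u) - finrank F ↑(u ⊓ w),
          finrank F ↑(w ⊓ perp u') - finrank F ↑(u' ⊓ w))) :
    ∑ x ∈ highPairs g m ×ˢ Finset.Icc 1 m, ∑ σ : isomGroup F g, ∑ γ : isomGroup F g,
        ind (BadTri φ (γ • A₁ (stdFlag F g x.1.1) (stdFlag F g x.1.2) (σ • stdFlag F g x.2))
          (γ • A₂ (stdFlag F g x.1.1) (stdFlag F g x.1.2) (σ • stdFlag F g x.2))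
          (γ • A₃ (stdFlag F g x.1.1) (stdFlag F g x.1.2) (σ • stdFlag F g x.2))) ≤
      tailConst * triTotal φ * (Finset.univ : Finset (isomGroup F g)).card := by
  refine le_trans (le_of_eq ?_) (sum_le_tailConst_mul (highPairs g m ×ˢ Finset.Icc 1 m)
    (Finset.univ : Finset (isomGroup F g))
    (fun x σ => finrank F ↑(σ • stdFlag F g x.2 ⊓ perp (stdFlag F g x.1.1)))
    (fun x σ => (finrank F ↑(σ • stdFlag F g x.2 ⊓ perp (stdFlag F g x.1.2)),
      finrank F ↑(σ • stdFlag F g x.2 ⊓ perp (stdFlag F g x.1.1)) -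
        finrank F ↑(stdFlag F g x.1.1 ⊓ σ • stdFlag F g x.2),
      finrank F ↑(σ • stdFlag F g x.2 ⊓ perp (stdFlag F g x.1.2)) -
        finrank F ↑(stdFlag F g x.1.2 ⊓ σ • stdFlag F g x.2)))
    ?_ ?_ T hT (triWeight φ) triWeight_nonneg (triTotal φ) sum_triWeight_le)
  · refine Finset.sum_congr rfl fun x hx => Finset.sum_congr rfl fun σ _ => ?_
    obtain ⟨h1, h2, h3, h4, h5⟩ := hA x hx σ _ _ _ rfl rfl rfl
    rw [sum_ind_badTri h3 h1 h2 rfl rfl rfl h4, h5]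
  · intro x hx σ _
    rw [Finset.mem_product, mem_highPairs] at hx
    have h1 : finrank F ↑(σ • stdFlag F g x.2 ⊓ perp (stdFlag F g x.1.2)) ≤
        finrank F ↑(σ • stdFlag F g x.2 ⊓ perp (stdFlag F g x.1.1)) :=
      Submodule.finrank_mono (inf_le_inf_left _
        (LinearMap.BilinForm.orthogonal_le (stdFlag_mono hx.1.2.1)))
    exact ⟨h1, Nat.sub_le _ _, (Nat.sub_le _ _).trans h1⟩
  · intro x hx r
    rw [Finset.mem_product, mem_highPairs, Finset.mem_Icc] at hx
    have := card_finrank_inf_perp_tail (F := F) (g := g) (n := 0) (a := x.1.1) (b := x.2)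
      (Nat.zero_le _) (by omega) (by omega) r
    rw [flagStab_zero] at this
    exact this

/-- The order relations and dimensions of the ladder, shared by the five families. As dim w ≤ m <
dim u, the subspace `mid u w` is nonzero. -/
lemma cone_position {m : ℕ} {x : (ℕ × ℕ) × ℕ} (hx : x ∈ highPairs g m ×ˢ Finset.Icc 1 m)
    (σ : isomGroup F g) {u u' w : Submodule F (Space F g)} (hu : u = stdFlag F g x.1.1)
    (hu' : u' = stdFlag F g x.1.2) (hw : w = σ • stdFlag F g x.2) :
    x.2 < x.1.1 ∧ 1 ≤ x.2 ∧ u ≤ u' ∧ mid u w ≤ mid u' w ∧ hinge u w ≤ hinge u' w ∧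
      IsIsotropic F g u' ∧ IsIsotropic F g (hinge u' w) ∧
      finrank F u = x.1.1 ∧ finrank F u' = x.1.2 ∧ finrank F w = x.2 ∧
      finrank F (mid u w) = x.1.1 - x.2 + finrank F ↑(w ⊓ perp u) ∧
      finrank F (mid u' w) = x.1.2 - x.2 + finrank F ↑(w ⊓ perp u') ∧
      finrank F (hinge u w) = x.1.1 + (finrank F ↑(w ⊓ perp u) - finrank F ↑(u ⊓ w)) ∧
      finrank F (hinge u' w) = x.1.2 + (finrank F ↑(w ⊓ perp u') - finrank F ↑(u' ⊓ w)) := by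
  rw [Finset.mem_product, mem_highPairs, Finset.mem_Icc] at hx
  have h1 : u ≤ u' := by rw [hu, hu']; exact stdFlag_mono hx.1.2.1
  have h2 : IsIsotropic F g u' := by rw [hu']; exact isIsotropic_stdFlag _
  have h3 : IsIsotropic F g w := by rw [hw]; exact (isIsotropic_stdFlag _).smul σ
  have h4 : finrank F u = x.1.1 := by rw [hu]; exact finrank_stdFlag (by omega)
  have h5 : finrank F u' = x.1.2 := by rw [hu']; exact finrank_stdFlag (by omega)
  have h6 : finrank F w = x.2 := by rw [hw, finrank_smul]; exact finrank_stdFlag (by omega)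
  have h7 : mid u w ≤ mid u' w := inf_le_inf_right _ h1
  refine ⟨by omega, by omega, h1, h7, sup_le_sup_right h7 _, h2, isIsotropic_hinge h2 h3, h4, h5,
    h6, ?_, ?_, ?_, ?_⟩
  · rw [finrank_mid (by omega), h4, h6]
  · rw [finrank_mid (by omega), h5, h6]
  · rw [finrank_hinge (h2.mono h1) h3, h4]
  · rw [finrank_hinge h2 h3, h5]

/-- On the index set j ≤ m < a and m < b, so the truncated differences a - j and b - j in the types
are genuine and j can be recovered from them. -/
lemma injOn_cone_type {m : ℕ} {T : (ℕ × ℕ) × ℕ → ℕ × ℕ × ℕ}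
    (hT : ∀ a b j a' b' j' : ℕ, m < a → m < b → j ≤ m → m < a' → m < b' → j' ≤ m →
      T ((a, b), j) = T ((a', b'), j') → a = a' ∧ b = b' ∧ j = j') :
    Set.InjOn T ↑(highPairs g m ×ˢ Finset.Icc 1 m) := by
  intro ⟨⟨a, b⟩, j⟩ hx ⟨⟨a', b'⟩, j'⟩ hy hxy
  rw [Finset.mem_coe, Finset.mem_product, mem_highPairs, Finset.mem_Icc] at hx hy
  simp only at hx hy
  obtain ⟨rfl, rfl, rfl⟩ := hT a b j a' b' j' (by omega) (by omega) (by omega) (by omega)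
    (by omega) (by omega) hxy
  rfl

/-- Writing the apex translation as γσ turns a random edge and an independent random apex into a
random translate of a standard edge with a randomly placed apex. -/
lemma sum_highTotal_coneFn (m : ℕ) :
    ∑ q ∈ Finset.Icc 1 m ×ˢ (Finset.univ : Finset (isomGroup F g)),
      highTotal φ (coneFn φ (q.2 • stdFlag F g q.1)) m =
      ∑ x ∈ highPairs g m ×ˢ Finset.Icc 1 m, ∑ σ : isomGroup F g, ∑ γ : isomGroup F g,
        ind (BadEdge φ (coneFn φ (γ • σ • stdFlag F g x.2)) (γ • stdFlag F g x.1.1) (γ • stdFlag F g x.1.2)) := by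
  rw [Finset.sum_product]
  simp only [highTotal, edgeWeight]
  rw [Finset.sum_product, Finset.sum_comm]
  calc _ = ∑ j ∈ Finset.Icc 1 m, ∑ p ∈ highPairs g m, ∑ κ : isomGroup F g,
        ∑ γ : isomGroup F g, ind (BadEdge φ (coneFn φ (κ • stdFlag F g j)) (γ • stdFlag F g p.1) (γ • stdFlag F g p.2)) := by
        rw [Finset.sum_comm]
        exact Finset.sum_congr rfl fun j _ => Finset.sum_comm
    _ = ∑ p ∈ highPairs g m, ∑ j ∈ Finset.Icc 1 m, ∑ κ : isomGroup F g,
        ∑ γ : isomGroup F g, ind (BadEdge φ (coneFn φ (κ • stdFlag F g j)) (γ • stdFlag F g p.1) (γ • stdFlag F g p.2)) :=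
        Finset.sum_comm
    _ = _ := by
        refine Finset.sum_congr rfl fun p _ => Finset.sum_congr rfl fun j _ => ?_
        refine Finset.sum_comm.trans (Eq.trans ?_ Finset.sum_comm)
        refine Finset.sum_congr rfl fun γ _ => ?_
        rw [← Equiv.sum_comp (Equiv.mulLeft γ)]
        simp only [Equiv.coe_mulLeft, mul_smul]

lemma sum_highTotal_coneFn_le (hφ : ∀ U V, φ U V = (φ V U)⁻¹) (m : ℕ) :
    ∑ q ∈ Finset.Icc 1 m ×ˢ (Finset.univ : Finset (isomGroup F g)),
      highTotal φ (coneFn φ (q.2 • stdFlag F g q.1)) m ≤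
      5 * (tailConst * triTotal φ * (Finset.univ : Finset (isomGroup F g)).card) := by
  have t1 := sum_cone_triangle_le (φ := φ) (m := m) (fun u u' w => w)
    (fun u u' w => hinge u w) (fun u u' w => hinge u' w) (fun x r d => (x.2, x.1.1 + d.2.1, x.1.2 + d.2.2))
    (fun r d => injOn_cone_type (by
      intro a b j a' b' j' _ _ _ _ _ _ h
      simp only [Prod.mk.injEq] at h
      omega))
    (by
      intro x hx σ u u' w hu hu' hw
      obtain ⟨h1, h2, hu₁, hz₁, hy₁, hu₂, hy₂, e1, e2, e3, e4, e5, e6, e7⟩ :=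
        cone_position hx σ hu hu' hw
      exact ⟨le_sup_right, hy₁, hy₂, by omega, by rw [e3, e6, e7]⟩)
  have t2 := sum_cone_triangle_le (φ := φ) (m := m) (fun u u' w => mid u w)
    (fun u u' w => hinge u w) (fun u u' w => hinge u' w) (fun x r d => (x.1.1 - x.2 + r, x.1.1 + d.2.1, x.1.2 + d.2.2))
    (fun r d => injOn_cone_type (by
      intro a b j a' b' j' _ _ _ _ _ _ h
      simp only [Prod.mk.injEq] at h
      omega))
    (by
      intro x hx σ u u' w hu hu' hw
      obtain ⟨h1, h2, hu₁, hz₁, hy₁, hu₂, hy₂, e1, e2, e3, e4, e5, e6, e7⟩ :=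
        cone_position hx σ hu hu' hw
      exact ⟨le_sup_left, hy₁, hy₂, by omega, by rw [e4, e6, e7]⟩)
  have t3 := sum_cone_triangle_le (φ := φ) (m := m) (fun u u' w => mid u w)
    (fun u u' w => mid u' w) (fun u u' w => hinge u' w) (fun x r d => (x.1.1 - x.2 + r, x.1.2 - x.2 + d.1, x.1.2 + d.2.2))
    (fun r d => injOn_cone_type (by
      intro a b j a' b' j' _ _ _ _ _ _ h
      simp only [Prod.mk.injEq] at h
      omega))
    (by
      intro x hx σ u u' w hu hu' hw
      obtain ⟨h1, h2, hu₁, hz₁, hy₁, hu₂, hy₂, e1, e2, e3, e4, e5, e6, e7⟩ :=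
        cone_position hx σ hu hu' hw
      exact ⟨hz₁, le_sup_left, hy₂, by omega, by rw [e4, e5, e7]⟩)
  have t4 := sum_cone_triangle_le (φ := φ) (m := m) (fun u u' w => mid u w)
    (fun u u' w => mid u' w) (fun u u' w => u') (fun x r d => (x.1.1 - x.2 + r, x.1.2 - x.2 + d.1, x.1.2))
    (fun r d => injOn_cone_type (by
      intro a b j a' b' j' _ _ _ _ _ _ h
      simp only [Prod.mk.injEq] at h
      omega))
    (by
      intro x hx σ u u' w hu hu' hw
      obtain ⟨h1, h2, hu₁, hz₁, hy₁, hu₂, hy₂, e1, e2, e3, e4, e5, e6, e7⟩ :=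
        cone_position hx σ hu hu' hw
      exact ⟨hz₁, inf_le_left, hu₂, by omega, by rw [e4, e5, e2]⟩)
  have t5 := sum_cone_triangle_le (φ := φ) (m := m) (fun u u' w => mid u w)
    (fun u u' w => u) (fun u u' w => u') (fun x r d => (x.1.1 - x.2 + r, x.1.1, x.1.2))
    (fun r d => injOn_cone_type (by
      intro a b j a' b' j' _ _ _ _ _ _ h
      simp only [Prod.mk.injEq] at h
      omega))
    (by
      intro x hx σ u u' w hu hu' hw
      obtain ⟨h1, h2, hu₁, hz₁, hy₁, hu₂, hy₂, e1, e2, e3, e4, e5, e6, e7⟩ :=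
        cone_position hx σ hu hu' hw
      exact ⟨inf_le_left, hu₁, hu₂, by omega, by rw [e4, e1, e2]⟩)
  rw [sum_highTotal_coneFn]
  refine le_trans ?_ ((add_le_add (add_le_add (add_le_add (add_le_add t1 t2) t3) t4) t5).trans
    (le_of_eq (by ring)))
  simp only [← Finset.sum_add_distrib]
  refine Finset.sum_le_sum fun x _ => Finset.sum_le_sum fun σ _ => Finset.sum_le_sum fun γ _ => ?_
  have := ind_badEdge_coneFn_le hφ (γ • σ • stdFlag F g x.2) (γ • stdFlag F g x.1.1)
    (γ • stdFlag F g x.1.2)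
  simpa only [smul_hinge, smul_mid] using this

lemma exists_mul_card_le {ι : Type*} {S : Finset ι} (hS : S.Nonempty) {f : ι → ℝ} {M : ℝ}
    (h : ∑ x ∈ S, f x ≤ M) : ∃ x ∈ S, S.card * f x ≤ M := by
  have hc : (0 : ℝ) < S.card := Nat.cast_pos.2 hS.card_pos
  obtain ⟨x, hx, hx'⟩ := Finset.exists_le_of_sum_le (s := S) (f := f) (g := fun _ => M / S.card) hS
    (by rwa [Finset.sum_const, nsmul_eq_mul, mul_div_cancel₀ _ hc.ne'])
  rw [le_div_iff₀ hc, mul_comm] at hx'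
  exact ⟨x, hx, hx'⟩

/-- The best apex is at least as good as the average over m dimensions and all translates. Since the
sum over all apex dimensions is bounded by the triangle total, the m choices yield the factor m. -/
lemma exists_highTotal_le (hφ : ∀ U V, φ U V = (φ V U)⁻¹) {m : ℕ} (hm : 1 ≤ m) :
    ∃ h : Submodule F (Space F g) → Γ, m * highTotal φ h m ≤ 5 * tailConst * triTotal φ := by
  have hnpos : 0 < (Finset.univ : Finset (isomGroup F g)).card :=
    Finset.card_pos.2 ⟨1, Finset.mem_univ _⟩
  obtain ⟨q, -, hq⟩ := exists_mul_card_le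
    (Finset.Nonempty.product ⟨1, Finset.mem_Icc.2 ⟨le_rfl, hm⟩⟩ ⟨1, Finset.mem_univ _⟩)
    (sum_highTotal_coneFn_le hφ m)
  refine ⟨coneFn φ (q.2 • stdFlag F g q.1), ?_⟩
  rw [Finset.card_product, Nat.card_Icc, Nat.add_sub_cancel, Nat.cast_mul] at hq
  generalize ((Finset.univ : Finset (isomGroup F g)).card) = n at hq hnpos
  have hn : (0 : ℝ) < n := Nat.cast_pos.2 hnpos
  refine le_of_mul_le_mul_right ?_ hn
  generalize highTotal φ (coneFn φ (q.2 • stdFlag F g q.1)) m = X at *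
  linarith

end High

/-! ### Values at vertices of dimension at most m. -/

section Low

variable {F : Type u} [Field F] [Finite F] {g : ℕ} {Γ : Type w}

open Classical in
-- The isometries carrying the i-th step to v form a coset of its stabilizer.
lemma sum_fiber_eq {i : ℕ} {v : Submodule F (Space F g)} {γ : isomGroup F g}
    (hγ : γ • stdFlag F g i = v) (f : isomGroup F g → ℝ) :
    ∑ κ ∈ Finset.univ.filter (fun κ : isomGroup F g => κ • stdFlag F g i = v), f κ =
      ∑ σ ∈ flagStab F g i, f (γ * σ) := by
  refine (Finset.sum_bij (fun σ _ => γ * σ) ?_ ?_ ?_ ?_).symm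
  · intro σ hσ
    rw [Finset.mem_filter, mul_smul, mem_flagStab.1 hσ]
    exact ⟨Finset.mem_univ _, hγ⟩
  · intro a _ b _ h
    exact mul_left_cancel h
  · intro κ hκ
    rw [Finset.mem_filter] at hκ
    refine ⟨γ⁻¹ * κ, mem_flagStab.2 ?_, mul_inv_cancel_left _ _⟩
    rw [mul_smul, hκ.2, ← hγ, inv_smul_smul]
  · intro _ _
    rfl

open Classical in
/-- Choosing the value at every vertex `γ • stdFlag i` as the best of the proposed values `q`, the
disagreement with `p` is at most that of two independent proposals at the vertex. -/
lemma exists_best_value (i : ℕ) (A M : Finset ℕ) (hM : M.Nonempty)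
    (p q : isomGroup F g → ℕ → Γ) :
    ∃ x : Submodule F (Space F g) → Γ,
      ((flagStab F g i).card * M.card : ℝ) *
          ∑ γ : isomGroup F g, ∑ a ∈ A, ind (p γ a ≠ x (γ • stdFlag F g i)) ≤
        ∑ γ : isomGroup F g, ∑ σ ∈ flagStab F g i, ∑ b ∈ M, ∑ a ∈ A,
          ind (p γ a ≠ q (γ * σ) b) := by
  let fib : Submodule F (Space F g) → Finset (isomGroup F g) := fun v =>
    Finset.univ.filter fun κ => κ • stdFlag F g i = v
  have hmem : ∀ {v γ}, γ ∈ fib v ↔ γ • stdFlag F g i = v := by simp [fib]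
  have hex : ∀ v, ∃ x : Γ, ((flagStab F g i).card * M.card : ℝ) *
      ∑ γ ∈ fib v, ∑ a ∈ A, ind (p γ a ≠ x) ≤
      ∑ γ ∈ fib v, ∑ σ ∈ flagStab F g i, ∑ b ∈ M, ∑ a ∈ A, ind (p γ a ≠ q (γ * σ) b) := by
    intro v
    rcases (fib v).eq_empty_or_nonempty with he | hne
    -- Arbitrary value at subspaces that are not translates of the i-th step.
    · exact ⟨q 1 0, by simp [he]⟩
    obtain ⟨κ, -, hκ⟩ := exists_mul_card_le (hne.product hM)
      (f := fun κ => ∑ γ ∈ fib v, ∑ a ∈ A, ind (p γ a ≠ q κ.1 κ.2)) le_rfl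
    refine ⟨q κ.1 κ.2, ?_⟩
    obtain ⟨γ₀, hγ₀⟩ := hne
    have hcard : ((fib v).card : ℝ) = (flagStab F g i).card := by
      have := sum_fiber_eq (hmem.1 hγ₀) fun _ => (1 : ℝ)
      simpa using this
    rw [Finset.card_product, Nat.cast_mul, hcard] at hκ
    refine hκ.trans (le_of_eq ?_)
    calc _ = ∑ κ ∈ fib v, ∑ b ∈ M, ∑ γ ∈ fib v, ∑ a ∈ A, ind (p γ a ≠ q κ b) :=
          Finset.sum_product _ _ _
      _ = ∑ κ ∈ fib v, ∑ γ ∈ fib v, ∑ b ∈ M, ∑ a ∈ A, ind (p γ a ≠ q κ b) :=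
          Finset.sum_congr rfl fun κ _ => Finset.sum_comm
      _ = ∑ γ ∈ fib v, ∑ κ ∈ fib v, ∑ b ∈ M, ∑ a ∈ A, ind (p γ a ≠ q κ b) := Finset.sum_comm
      _ = _ := Finset.sum_congr rfl fun γ hγ =>
          sum_fiber_eq (hmem.1 hγ) fun κ => ∑ b ∈ M, ∑ a ∈ A, ind (p γ a ≠ q κ b)
  choose x hx using hex
  have : Finite (Submodule F (Space F g)) := Finite.of_injective _ SetLike.coe_injective
  have : Fintype (Submodule F (Space F g)) := Fintype.ofFinite _
  refine ⟨x, ?_⟩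
  rw [← Finset.sum_fiberwise Finset.univ (fun γ : isomGroup F g => γ • stdFlag F g i),
    ← Finset.sum_fiberwise Finset.univ (fun γ : isomGroup F g => γ • stdFlag F g i)
      (fun γ => ∑ σ ∈ flagStab F g i, ∑ b ∈ M, ∑ a ∈ A, ind (p γ a ≠ q (γ * σ) b)),
    Finset.mul_sum]
  refine Finset.sum_le_sum fun v _ => le_trans (le_of_eq ?_) (hx v)
  congr 1
  refine Finset.sum_congr rfl fun γ hγ => ?_
  rw [(Finset.mem_filter.1 hγ).2]

variable [Group Γ] {φ : Submodule F (Space F g) → Submodule F (Space F g) → Γ}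

lemma link_position {m i : ℕ} (hi : i ≤ m) {x : ℕ × ℕ}
    (hx : x ∈ Finset.Icc (3 * m) g ×ˢ Finset.Icc (m + 1) (2 * m))
    {σ : isomGroup F g} (hσ : σ ∈ flagStab F g i) {u w v : Submodule F (Space F g)}
    (hv : v = stdFlag F g i) (hu : u = stdFlag F g x.1) (hw : w = σ • stdFlag F g x.2) :
    (m < x.2 ∧ x.2 + m ≤ x.1 ∧ x.1 ≤ g) ∧ v ≤ mid u w ∧ v ≤ w ∧
      IsIsotropic F g u ∧ IsIsotropic F g (hinge u w) ∧
      finrank F v = i ∧ finrank F u = x.1 ∧ finrank F w = x.2 ∧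
      i ≤ finrank F ↑(w ⊓ perp u) ∧ i ≤ finrank F ↑(u ⊓ w) ∧
      finrank F (mid u w) = x.1 - x.2 + (i + (finrank F ↑(w ⊓ perp u) - i)) ∧
      finrank F (hinge u w) = x.1 + (finrank F ↑(w ⊓ perp u) - finrank F ↑(u ⊓ w)) := by
  rw [Finset.mem_product, Finset.mem_Icc, Finset.mem_Icc] at hx
  have h1 : v ≤ u := by rw [hu, hv]; exact stdFlag_mono (by omega)
  have h2 : v ≤ w := by
    rw [hv, hw, ← mem_flagStab.1 hσ]
    exact smul_le_smul_iff'.2 (stdFlag_mono (by omega))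
  have h3 : IsIsotropic F g w := by rw [hw]; exact (isIsotropic_stdFlag _).smul σ
  have h4 : IsIsotropic F g u := by rw [hu]; exact isIsotropic_stdFlag _
  have h5 : finrank F v = i := by rw [hv]; exact finrank_stdFlag (by omega)
  have h6 : finrank F u = x.1 := by rw [hu]; exact finrank_stdFlag (by omega)
  have h7 : finrank F w = x.2 := by rw [hw, finrank_smul]; exact finrank_stdFlag (by omega)
  have h8 : i ≤ finrank F ↑(w ⊓ perp u) := by
    rw [← h5]
    exact Submodule.finrank_mono (le_inf h2 (h1.trans (isIsotropic_iff_le_perp.1 h4)))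
  refine ⟨by omega, le_inf h1 (h2.trans (isIsotropic_iff_le_perp.1 h3)), h2, h4,
    isIsotropic_hinge h4 h3, h5, h6, h7, h8, ?_, ?_, ?_⟩
  · rw [← h5]
    exact Submodule.finrank_mono (le_inf h1 h2)
  · rw [finrank_mid (by omega), h6, h7, Nat.add_sub_cancel' h8]
  · rw [finrank_hinge h4 h3, h6]

/-- Here one excess dimension describes the deviation; the two zeros pad it to the triple expected
by `sum_le_tailConst_mul`. Dimensions are compared relative to the fixed v of dimension i, so the
tail is that of the stabilizer of v. -/
lemma sum_link_le {m i : ℕ} (hi : i ≤ m) (T : ℕ × ℕ → ℕ → ℕ × ℕ × ℕ → ℕ × ℕ)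
    (hT : ∀ r d a b a' b' : ℕ, b ≤ a → b' ≤ a' → T (a, b) r (d, 0, 0) = T (a', b') r (d, 0, 0) →
      a = a' ∧ b = b')
    {β : ℕ × ℕ → ℝ} (hβ : ∀ t, 0 ≤ β t) {B : ℝ} (hB : ∀ A : Finset (ℕ × ℕ), ∑ t ∈ A, β t ≤ B)
    (f : ℕ × ℕ → isomGroup F g → ℝ)
    (hf : ∀ x ∈ Finset.Icc (3 * m) g ×ˢ Finset.Icc (m + 1) (2 * m), ∀ σ ∈ flagStab F g i,
      ∀ u w, u = stdFlag F g x.1 → w = σ • stdFlag F g x.2 →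
      f x σ = β (T x (finrank F ↑(w ⊓ perp u) - i)
        (finrank F ↑(w ⊓ perp u) - finrank F ↑(u ⊓ w), 0, 0))) :
    ∑ x ∈ Finset.Icc (3 * m) g ×ˢ Finset.Icc (m + 1) (2 * m), ∑ σ ∈ flagStab F g i, f x σ ≤
      tailConst * B * (flagStab F g i).card := by
  refine le_trans (le_of_eq ?_) (sum_le_tailConst_mul
    (Finset.Icc (3 * m) g ×ˢ Finset.Icc (m + 1) (2 * m)) (flagStab F g i)
    (fun x σ => finrank F ↑(σ • stdFlag F g x.2 ⊓ perp (stdFlag F g x.1)) - i)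
    (fun x σ => (finrank F ↑(σ • stdFlag F g x.2 ⊓ perp (stdFlag F g x.1)) -
        finrank F ↑(stdFlag F g x.1 ⊓ σ • stdFlag F g x.2), 0, 0))
    ?_ ?_ (fun x r d => T x r (d.1, 0, 0)) ?_ β hβ B hB)
  · exact Finset.sum_congr rfl fun x hx => Finset.sum_congr rfl fun σ hσ =>
      hf x hx σ hσ _ _ rfl rfl
  · intro x hx σ hσ
    obtain ⟨-, -, -, -, -, -, -, -, -, h, -⟩ := link_position hi hx hσ rfl rfl rfl
    exact ⟨Nat.sub_le_sub_left h _, Nat.zero_le _, Nat.zero_le _⟩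
  · intro x hx r
    rw [Finset.mem_product, Finset.mem_Icc, Finset.mem_Icc] at hx
    exact card_finrank_inf_perp_tail (by omega) (by omega) (by omega) r
  · intro r d ⟨a, b⟩ hx ⟨a', b'⟩ hy hxy
    rw [Finset.mem_coe, Finset.mem_product, Finset.mem_Icc, Finset.mem_Icc] at hx hy
    simp only at hx hy
    obtain ⟨rfl, rfl⟩ := hT r d.1 a b a' b' (by omega) (by omega) hxy
    rfl

/-- The proposal φ(v,·) h(·) is transported from u to w through `mid u w` and `hinge u w`. It stays
constant along each of the three edges of the path if h is good on that edge and the triangle over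
it with apex v satisfies the cocycle condition. -/
lemma ind_ne_le_of_hinge (h : Submodule F (Space F g) → Γ) (v u w : Submodule F (Space F g)) :
    ind (φ v u * h u ≠ φ v w * h w) ≤
      ind (BadTri φ v (mid u w) u) + ind (BadTri φ v (mid u w) (hinge u w)) +
      ind (BadTri φ v w (hinge u w)) + ind (BadEdge φ h (mid u w) u) +
      ind (BadEdge φ h (mid u w) (hinge u w)) + ind (BadEdge φ h w (hinge u w)) := by
  have key : φ v u * h u ≠ φ v w * h w → ((((BadTri φ v (mid u w) u ∨
      BadTri φ v (mid u w) (hinge u w)) ∨ BadTri φ v w (hinge u w)) ∨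
      BadEdge φ h (mid u w) u) ∨ BadEdge φ h (mid u w) (hinge u w)) ∨
      BadEdge φ h w (hinge u w) := by
    intro hne
    by_contra hcon
    simp only [not_or, BadTri, BadEdge, not_not] at hcon
    obtain ⟨⟨⟨⟨⟨h1, h2⟩, h3⟩, h4⟩, h5⟩, h6⟩ := hcon
    refine hne ?_
    rw [h4] at h1
    rw [h5, ← h3, h6, ← mul_assoc, ← mul_assoc] at h2
    rw [← h1, ← mul_assoc, inv_mul_cancel_right]
    exact mul_right_cancel h2
  refine (ind_mono key).trans ((ind_or_le _ _).trans (add_le_add_left ?_ _))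
  refine (ind_or_le _ _).trans (add_le_add_left ?_ _)
  refine (ind_or_le _ _).trans (add_le_add_left ?_ _)
  refine (ind_or_le _ _).trans (add_le_add_left ?_ _)
  exact ind_or_le _ _

/-- The total weight of the triangles with first dimension `i` on which the cocycle condition
fails. -/
noncomputable def triTotalAt (φ : Submodule F (Space F g) → Submodule F (Space F g) → Γ) (i : ℕ) :
    ℝ :=
  ∑ t ∈ Finset.Icc 1 g ×ˢ Finset.Icc 1 g, triWeight φ (i, t)

lemma sum_triWeight_at_le (i : ℕ) (A : Finset (ℕ × ℕ)) :
    ∑ t ∈ A, triWeight φ (i, t) ≤ triTotalAt φ i :=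
  sum_le_sum_of_support (fun t => triWeight_nonneg _)
    (fun t ht => (Finset.mem_product.1 (triWeight_support _ ht)).2) A

open Classical in
lemma sum_edgeWeight_high_le (h : Submodule F (Space F g) → Γ) (m : ℕ) (A : Finset (ℕ × ℕ)) :
    ∑ t ∈ A, (if t ∈ highPairs g m then edgeWeight φ h t.1 t.2 else 0) ≤ highTotal φ h m := by
  refine (sum_le_sum_of_support (S := highPairs g m) (fun t => ?_) (fun t ht => ?_) A).trans
    (le_of_eq (Finset.sum_congr rfl fun t ht => if_pos ht))
  · split_ifs
    · exact edgeWeight_nonneg _ _ _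
    · exact le_rfl
  · by_contra hn
    exact ht (if_neg hn)

open Classical in
-- Proposals from dimensions a ≥ 3m are tested against candidates from the m dimensions b in (m,
-- 2m]. Then a - b ≥ m, so `mid` has dimension at least m + i > m and all three edges of the hinge
-- path are high. The factor 3 counts the three triangles and the three edges.
lemma exists_low_value (h : Submodule F (Space F g) → Γ) {m i : ℕ} (hi : 1 ≤ i) (him : i ≤ m) :
    ∃ x : Submodule F (Space F g) → Γ,
      m * ∑ γ : isomGroup F g, ∑ a ∈ Finset.Icc (3 * m) g,
        ind (φ (γ • stdFlag F g i) (γ • stdFlag F g a) * h (γ • stdFlag F g a) ≠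
          x (γ • stdFlag F g i)) ≤
      3 * tailConst * (triTotalAt φ i + highTotal φ h m) := by
  obtain ⟨x, hx⟩ := exists_best_value (F := F) (g := g) i (Finset.Icc (3 * m) g)
    (Finset.Icc (m + 1) (2 * m)) ⟨m + 1, Finset.mem_Icc.2 (by omega)⟩
    (fun γ a => φ (γ • stdFlag F g i) (γ • stdFlag F g a) * h (γ • stdFlag F g a))
    (fun κ b => φ (κ • stdFlag F g i) (κ • stdFlag F g b) * h (κ • stdFlag F g b))
  refine ⟨x, ?_⟩
  set n : ℕ := (flagStab F g i).card with hn
  have hnpos : (0 : ℝ) < n := Nat.cast_pos.2 (Finset.card_pos.2 ⟨1, one_mem_flagStab i⟩)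
  set I := Finset.Icc (3 * m) g ×ˢ Finset.Icc (m + 1) (2 * m) with hI
  have hswap : ∑ γ : isomGroup F g, ∑ σ ∈ flagStab F g i, ∑ b ∈ Finset.Icc (m + 1) (2 * m),
      ∑ a ∈ Finset.Icc (3 * m) g,
        ind (φ (γ • stdFlag F g i) (γ • stdFlag F g a) * h (γ • stdFlag F g a) ≠
          φ ((γ * σ) • stdFlag F g i) ((γ * σ) • stdFlag F g b) * h ((γ * σ) • stdFlag F g b)) =
      ∑ x ∈ I, ∑ σ ∈ flagStab F g i, ∑ γ : isomGroup F g,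
        ind (φ (γ • stdFlag F g i) (γ • stdFlag F g x.1) * h (γ • stdFlag F g x.1) ≠
          φ (γ • stdFlag F g i) (γ • σ • stdFlag F g x.2) * h (γ • σ • stdFlag F g x.2)) := by
    rw [Finset.sum_comm]
    rw [Finset.sum_comm (s := I)]
    refine Finset.sum_congr rfl fun σ hσ => ?_
    rw [Finset.sum_comm (s := I)]
    refine Finset.sum_congr rfl fun γ _ => ?_
    rw [hI, Finset.sum_product, Finset.sum_comm]
    simp only [mul_smul, mem_flagStab.1 hσ]
  have hle : ∑ x ∈ I, ∑ σ ∈ flagStab F g i, ∑ γ : isomGroup F g,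
        ind (φ (γ • stdFlag F g i) (γ • stdFlag F g x.1) * h (γ • stdFlag F g x.1) ≠
          φ (γ • stdFlag F g i) (γ • σ • stdFlag F g x.2) * h (γ • σ • stdFlag F g x.2)) ≤
      3 * (tailConst * triTotalAt φ i * n) + 3 * (tailConst * highTotal φ h m * n) := by
    have hβ : ∀ t : ℕ × ℕ, 0 ≤ if t ∈ highPairs g m then edgeWeight φ h t.1 t.2 else 0 :=
      fun t => by
        split_ifs
        · exact edgeWeight_nonneg _ _ _
        · exact le_rfl
    have t1 := sum_link_le (F := F) (g := g) him (fun x r d => (x.1 - x.2 + (i + r), x.1))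
      (fun r d a b a' b' _ _ hab => by simp only [Prod.mk.injEq] at hab; omega)
      (fun t => triWeight_nonneg (φ := φ) (i, t)) (sum_triWeight_at_le i)
      (fun x σ => ∑ γ : isomGroup F g, ind (BadTri φ (γ • stdFlag F g i)
        (γ • mid (stdFlag F g x.1) (σ • stdFlag F g x.2)) (γ • stdFlag F g x.1))) (by
      intro x hx σ hσ _ _ hu hw
      subst hu hw
      obtain ⟨h1, h2, h3, h4, h5, e1, e2, e3, e4, e5, e6, e7⟩ :=
        link_position him hx hσ rfl rfl rfl
      exact sum_ind_badTri h4 h2 inf_le_left e1 e6 e2 hi)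
    have t2 := sum_link_le (F := F) (g := g) him (fun x r d => (x.1 - x.2 + (i + r), x.1 + d.1))
      (fun r d a b a' b' _ _ hab => by simp only [Prod.mk.injEq] at hab; omega)
      (fun t => triWeight_nonneg (φ := φ) (i, t)) (sum_triWeight_at_le i)
      (fun x σ => ∑ γ : isomGroup F g, ind (BadTri φ (γ • stdFlag F g i)
        (γ • mid (stdFlag F g x.1) (σ • stdFlag F g x.2)) (γ • hinge (stdFlag F g x.1) (σ • stdFlag F g x.2)))) (by
      intro x hx σ hσ _ _ hu hw
      subst hu hw
      obtain ⟨h1, h2, h3, h4, h5, e1, e2, e3, e4, e5, e6, e7⟩ :=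
        link_position him hx hσ rfl rfl rfl
      exact sum_ind_badTri h5 h2 le_sup_left e1 e6 e7 hi)
    have t3 := sum_link_le (F := F) (g := g) him (fun x r d => (x.2, x.1 + d.1))
      (fun r d a b a' b' _ _ hab => by simp only [Prod.mk.injEq] at hab; omega)
      (fun t => triWeight_nonneg (φ := φ) (i, t)) (sum_triWeight_at_le i)
      (fun x σ => ∑ γ : isomGroup F g, ind (BadTri φ (γ • stdFlag F g i)
        (γ • σ • stdFlag F g x.2) (γ • hinge (stdFlag F g x.1) (σ • stdFlag F g x.2)))) (by
      intro x hx σ hσ _ _ hu hw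
      subst hu hw
      obtain ⟨h1, h2, h3, h4, h5, e1, e2, e3, e4, e5, e6, e7⟩ :=
        link_position him hx hσ rfl rfl rfl
      exact sum_ind_badTri h5 h3 le_sup_right e1 e3 e7 hi)
    have t4 := sum_link_le (F := F) (g := g) him (fun x r d => (x.1 - x.2 + (i + r), x.1))
      (fun r d a b a' b' _ _ hab => by simp only [Prod.mk.injEq] at hab; omega)
      (β := fun t => if t ∈ highPairs g m then edgeWeight φ h t.1 t.2 else 0) hβ
      (sum_edgeWeight_high_le h m)
      (fun x σ => ∑ γ : isomGroup F g, ind (BadEdge φ h (γ • mid (stdFlag F g x.1) (σ • stdFlag F g x.2))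
        (γ • stdFlag F g x.1))) (by
      intro x hx σ hσ _ _ hu hw
      subst hu hw
      obtain ⟨h1, h2, h3, h4, h5, e1, e2, e3, e4, e5, e6, e7⟩ :=
        link_position him hx hσ rfl rfl rfl
      have hle := Submodule.finrank_mono (inf_le_left : mid (stdFlag F g x.1) (σ • stdFlag F g x.2) ≤ stdFlag F g x.1)
      have hg := h4.finrank_le
      rw [e6, e2] at hle
      rw [e2] at hg
      exact (sum_ind_badEdge h4 (inf_le_left : mid (stdFlag F g x.1) (σ • stdFlag F g x.2) ≤ stdFlag F g x.1) e6 e2).trans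
          (if_pos (mem_highPairs.2 ⟨by simp only; omega, hle, hg⟩)).symm)
    have t5 := sum_link_le (F := F) (g := g) him (fun x r d => (x.1 - x.2 + (i + r), x.1 + d.1))
      (fun r d a b a' b' _ _ hab => by simp only [Prod.mk.injEq] at hab; omega)
      (β := fun t => if t ∈ highPairs g m then edgeWeight φ h t.1 t.2 else 0) hβ
      (sum_edgeWeight_high_le h m)
      (fun x σ => ∑ γ : isomGroup F g, ind (BadEdge φ h (γ • mid (stdFlag F g x.1) (σ • stdFlag F g x.2))
        (γ • hinge (stdFlag F g x.1) (σ • stdFlag F g x.2)))) (by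
      intro x hx σ hσ _ _ hu hw
      subst hu hw
      obtain ⟨h1, h2, h3, h4, h5, e1, e2, e3, e4, e5, e6, e7⟩ :=
        link_position him hx hσ rfl rfl rfl
      have hle := Submodule.finrank_mono (le_sup_left : mid (stdFlag F g x.1) (σ • stdFlag F g x.2) ≤ hinge (stdFlag F g x.1) (σ • stdFlag F g x.2))
      have hg := h5.finrank_le
      rw [e6, e7] at hle
      rw [e7] at hg
      exact (sum_ind_badEdge h5 (le_sup_left : mid (stdFlag F g x.1) (σ • stdFlag F g x.2) ≤ hinge (stdFlag F g x.1) (σ • stdFlag F g x.2)) e6 e7).trans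
          (if_pos (mem_highPairs.2 ⟨by simp only; omega, hle, hg⟩)).symm)
    have t6 := sum_link_le (F := F) (g := g) him (fun x r d => (x.2, x.1 + d.1))
      (fun r d a b a' b' _ _ hab => by simp only [Prod.mk.injEq] at hab; omega)
      (β := fun t => if t ∈ highPairs g m then edgeWeight φ h t.1 t.2 else 0) hβ
      (sum_edgeWeight_high_le h m)
      (fun x σ => ∑ γ : isomGroup F g, ind (BadEdge φ h (γ • σ • stdFlag F g x.2)
        (γ • hinge (stdFlag F g x.1) (σ • stdFlag F g x.2)))) (by
      intro x hx σ hσ _ _ hu hw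
      subst hu hw
      obtain ⟨h1, h2, h3, h4, h5, e1, e2, e3, e4, e5, e6, e7⟩ :=
        link_position him hx hσ rfl rfl rfl
      have hle := Submodule.finrank_mono (le_sup_right : σ • stdFlag F g x.2 ≤ hinge (stdFlag F g x.1) (σ • stdFlag F g x.2))
      have hg := h5.finrank_le
      rw [e3, e7] at hle
      rw [e7] at hg
      exact (sum_ind_badEdge h5 (le_sup_right : σ • stdFlag F g x.2 ≤ hinge (stdFlag F g x.1) (σ • stdFlag F g x.2)) e3 e7).trans
          (if_pos (mem_highPairs.2 ⟨by simp only; omega, hle, hg⟩)).symm)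
    refine le_trans ?_ ((add_le_add (add_le_add (add_le_add (add_le_add (add_le_add t1 t2) t3) t4)
      t5) t6).trans (le_of_eq (by ring)))
    simp only [← Finset.sum_add_distrib]
    refine Finset.sum_le_sum fun x _ => Finset.sum_le_sum fun σ _ => Finset.sum_le_sum fun γ _ => ?_
    have := ind_ne_le_of_hinge (φ := φ) h (γ • stdFlag F g i) (γ • stdFlag F g x.1)
      (γ • σ • stdFlag F g x.2)
    simpa only [smul_hinge, smul_mid] using this
  rw [hswap] at hx
  have hfin := hx.trans hle
  rw [Nat.card_Icc, show 2 * m + 1 - (m + 1) = m by omega] at hfin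
  refine le_of_mul_le_mul_right ?_ hnpos
  refine le_trans (le_of_eq ?_) (hfin.trans (le_of_eq ?_)) <;> ring

end Low

/-! ### Assembling all edge types. -/

section Total

variable {F : Type u} [Field F] [Finite F] {g : ℕ} {Γ : Type w} [Group Γ]
  {φ : Submodule F (Space F g) → Submodule F (Space F g) → Γ}

lemma sum_union_le {ι : Type*} [DecidableEq ι] {f : ι → ℝ} (hf : ∀ x, 0 ≤ f x) {S T U : Finset ι}
    (h : S ⊆ T ∪ U) : ∑ x ∈ S, f x ≤ ∑ x ∈ T, f x + ∑ x ∈ U, f x := by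
  rw [← Finset.sum_union_inter]
  have h1 : ∑ x ∈ S, f x ≤ ∑ x ∈ T ∪ U, f x :=
    Finset.sum_le_sum_of_subset_of_nonneg h fun x _ _ => hf x
  have h2 : 0 ≤ ∑ x ∈ T ∩ U, f x := Finset.sum_nonneg fun x _ => hf x
  linarith

lemma edgeWeight_le_of_apex (h : Submodule F (Space F g) → Γ) {a b c : ℕ} (ha : 1 ≤ a)
    (hab : a ≤ b) (hbc : b ≤ c) (hc : c ≤ g) :
    edgeWeight φ h a b ≤ edgeWeight φ h a c + edgeWeight φ h b c + triWeight φ (a, b, c) := by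
  rw [triWeight, if_pos ⟨ha, hab, hbc, hc⟩, edgeWeight, edgeWeight, edgeWeight,
    ← Finset.sum_add_distrib, ← Finset.sum_add_distrib]
  refine Finset.sum_le_sum fun γ _ => ?_
  refine le_trans (ind_mono fun hbad => ?_) ((ind_or_le (_ ∨ _) _).trans
    (add_le_add_left (ind_or_le _ _) _))
  by_contra hcon
  simp only [not_or, BadTri, BadEdge, not_not] at hcon
  obtain ⟨⟨h1, h2⟩, h3⟩ := hcon
  refine hbad ?_
  rw [h1, h2] at h3
  rw [← eq_mul_inv_iff_mul_eq] at h3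
  rw [h3]
  group

lemma sum_triTotalAt_le {m : ℕ} (hm : m ≤ g) : ∑ i ∈ Finset.Icc 1 m, triTotalAt φ i ≤ triTotal φ := by
  rw [triTotal, Finset.sum_product]
  exact Finset.sum_le_sum_of_subset_of_nonneg (Finset.Icc_subset_Icc_right hm)
    fun i _ _ => Finset.sum_nonneg fun t _ => triWeight_nonneg _

/-- Extending a function on high-dimensional subspaces to the low-dimensional ones. -/
lemma exists_extension (h₀ : Submodule F (Space F g) → Γ) {m : ℕ} (h3 : 3 * m ≤ g) :
    ∃ h : Submodule F (Space F g) → Γ, highTotal φ h m = highTotal φ h₀ m ∧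
      m * ∑ i ∈ Finset.Icc 1 m, ∑ a ∈ Finset.Icc (3 * m) g, edgeWeight φ h i a ≤
        3 * tailConst * (triTotal φ + m * highTotal φ h₀ m) := by
  have hex : ∀ i, ∃ x : Submodule F (Space F g) → Γ, 1 ≤ i → i ≤ m →
      m * ∑ γ : isomGroup F g, ∑ a ∈ Finset.Icc (3 * m) g,
        ind (φ (γ • stdFlag F g i) (γ • stdFlag F g a) * h₀ (γ • stdFlag F g a) ≠
          x (γ • stdFlag F g i)) ≤
      3 * tailConst * (triTotalAt φ i + highTotal φ h₀ m) := by
    intro i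
    by_cases hi : 1 ≤ i ∧ i ≤ m
    · obtain ⟨x, hx⟩ := exists_low_value (φ := φ) h₀ hi.1 hi.2
      exact ⟨x, fun _ _ => hx⟩
    · exact ⟨h₀, fun h1 h2 => (hi ⟨h1, h2⟩).elim⟩
  choose x hx using hex
  -- The choices made separately for each low dimension are glued by dimension; values above m are
  -- kept, so `highTotal` does not change.
  let h : Submodule F (Space F g) → Γ := fun U => if m < finrank F U then h₀ U else x (finrank F U) U
  have hhigh : ∀ (γ : isomGroup F g) a, m < a → a ≤ g →
      h (γ • stdFlag F g a) = h₀ (γ • stdFlag F g a) := by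
    intro γ a ha hag
    refine if_pos ?_
    rw [finrank_smul, finrank_stdFlag hag]
    exact ha
  have hlow : ∀ (γ : isomGroup F g) i, i ≤ m → h (γ • stdFlag F g i) = x i (γ • stdFlag F g i) := by
    intro γ i hi
    have hf : finrank F ↑(γ • stdFlag F g i) = i := by
      rw [finrank_smul, finrank_stdFlag (by omega)]
    have h1 : h (γ • stdFlag F g i) = x (finrank F ↑(γ • stdFlag F g i)) (γ • stdFlag F g i) :=
      if_neg (by rw [hf]; omega)
    rw [h1, hf]
  refine ⟨h, ?_, ?_⟩
  · refine Finset.sum_congr rfl fun p hp => Finset.sum_congr rfl fun γ _ => ?_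
    rw [mem_highPairs] at hp
    rw [BadEdge, BadEdge, hhigh γ p.1 (by omega) (by omega), hhigh γ p.2 (by omega) (by omega)]
  · have h1 : ∀ i ∈ Finset.Icc 1 m, m * ∑ a ∈ Finset.Icc (3 * m) g, edgeWeight φ h i a ≤
        3 * tailConst * (triTotalAt φ i + highTotal φ h₀ m) := by
      intro i hi
      rw [Finset.mem_Icc] at hi
      refine le_trans (le_of_eq ?_) (hx i hi.1 hi.2)
      congr 1
      simp only [edgeWeight]
      rw [Finset.sum_comm]
      refine Finset.sum_congr rfl fun γ _ => Finset.sum_congr rfl fun a ha => ?_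
      rw [Finset.mem_Icc] at ha
      -- An edge from a low vertex to a large one is bad exactly when the proposal from the large
      -- end differs from the chosen value.
      rw [BadEdge, hhigh γ a (by omega) (by omega), hlow γ i hi.2, Ne, eq_mul_inv_iff_mul_eq]
    rw [Finset.mul_sum]
    refine (Finset.sum_le_sum h1).trans ?_
    rw [← Finset.mul_sum, Finset.sum_add_distrib, Finset.sum_const, Nat.card_Icc,
      Nat.add_sub_cancel, nsmul_eq_mul]
    refine mul_le_mul_of_nonneg_left ?_ (mul_nonneg (by norm_num) tailConst_nonneg)
    exact add_le_add_left (sum_triTotalAt_le (by omega)) _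

/-- The weight of the edges of the remaining types is bounded through an apex of large
dimension. -/
lemma mul_sum_low_edgeWeight_le (h : Submodule F (Space F g) → Γ) {m : ℕ} (h1 : 1 ≤ m)
    (h3 : 3 * m ≤ g) (h4 : 4 * m ≤ g + 1) :
    m * ∑ p ∈ (Finset.Icc 1 m ×ˢ Finset.Icc 1 (3 * m - 1)).filter (fun p => p.1 ≤ p.2),
        edgeWeight φ h p.1 p.2 ≤
      3 * m * ∑ i ∈ Finset.Icc 1 m, ∑ a ∈ Finset.Icc (3 * m) g, edgeWeight φ h i a +
      m * (∑ i ∈ Finset.Icc 1 m, ∑ a ∈ Finset.Icc (3 * m) g, edgeWeight φ h i a +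
        highTotal φ h m) + triTotal φ := by
  classical
  set A := Finset.Icc (3 * m) g with hA
  set C := (Finset.Icc 1 m ×ˢ Finset.Icc 1 (3 * m - 1)).filter (fun p => p.1 ≤ p.2) with hC
  have hCmem : ∀ p ∈ C, 1 ≤ p.1 ∧ p.1 ≤ m ∧ p.1 ≤ p.2 ∧ p.2 < 3 * m := by
    intro p hp
    simp only [hC, Finset.mem_filter, Finset.mem_product, Finset.mem_Icc] at hp
    omega
  have hE : ∀ p : ℕ × ℕ, 0 ≤ edgeWeight φ h p.1 p.2 := fun p => edgeWeight_nonneg _ _ _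
  -- There are g + 1 - 3m apex dimensions, at least m of them because 4m ≤ g + 1; averaging over
  -- them gains the factor m.
  have hcard : (m : ℝ) ≤ A.card := by
    rw [hA, Nat.card_Icc]
    exact Nat.cast_le.2 (by omega)
  have hm0 : (0 : ℝ) ≤ m := Nat.cast_nonneg _
  have e1 : ∑ p ∈ C, ∑ c ∈ A, edgeWeight φ h p.1 c ≤
      3 * m * ∑ i ∈ Finset.Icc 1 m, ∑ a ∈ A, edgeWeight φ h i a := by
    refine (Finset.sum_le_sum_of_subset_of_nonneg (Finset.filter_subset _ _)
      fun p _ _ => Finset.sum_nonneg fun c _ => edgeWeight_nonneg _ _ _).trans ?_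
    rw [Finset.sum_product, Finset.mul_sum]
    refine Finset.sum_le_sum fun i _ => ?_
    dsimp only
    rw [Finset.sum_const, Nat.card_Icc, nsmul_eq_mul]
    refine mul_le_mul_of_nonneg_right ?_ (Finset.sum_nonneg fun c _ => edgeWeight_nonneg _ _ _)
    have : (3 * m - 1 + 1 - 1 : ℕ) ≤ 3 * m := by omega
    exact_mod_cast this
  -- The edge from the second vertex to the apex is of the already bounded low-to-large kind or is
  -- high, according to whether its smaller dimension is at most m. The m possible first dimensions
  -- give the factor.
  have e2 : ∑ p ∈ C, ∑ c ∈ A, edgeWeight φ h p.2 c ≤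
      m * (∑ i ∈ Finset.Icc 1 m, ∑ a ∈ A, edgeWeight φ h i a + highTotal φ h m) := by
    refine (Finset.sum_le_sum_of_subset_of_nonneg (Finset.filter_subset _ _)
      fun p _ _ => Finset.sum_nonneg fun c _ => edgeWeight_nonneg _ _ _).trans ?_
    rw [Finset.sum_product]
    dsimp only
    rw [Finset.sum_const, Nat.card_Icc, nsmul_eq_mul, Nat.add_sub_cancel]
    refine mul_le_mul_of_nonneg_left ?_ hm0
    rw [← Finset.sum_product' (Finset.Icc 1 (3 * m - 1)) A (edgeWeight φ h),
      ← Finset.sum_product' (Finset.Icc 1 m) A (edgeWeight φ h)]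
    refine sum_union_le hE fun p hp => ?_
    rw [Finset.mem_product, Finset.mem_Icc, hA, Finset.mem_Icc] at hp
    rw [Finset.mem_union, Finset.mem_product, Finset.mem_Icc, mem_highPairs, hA, Finset.mem_Icc]
    omega
  have e3 : ∑ p ∈ C, ∑ c ∈ A, triWeight φ (p.1, p.2, c) ≤ triTotal φ := by
    rw [← Finset.sum_product' C A fun p c => triWeight φ (p.1, p.2, c)]
    rw [← Finset.sum_image (g := fun q : (ℕ × ℕ) × ℕ => (q.1.1, q.1.2, q.2)) (f := triWeight φ)]
    · exact sum_triWeight_le _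
    · rintro ⟨⟨a, b⟩, c⟩ _ ⟨⟨a', b'⟩, c'⟩ _ heq
      simp only [Prod.mk.injEq] at heq
      obtain ⟨rfl, rfl, rfl⟩ := heq
      rfl
  calc m * ∑ p ∈ C, edgeWeight φ h p.1 p.2 ≤ A.card * ∑ p ∈ C, edgeWeight φ h p.1 p.2 :=
        mul_le_mul_of_nonneg_right hcard (Finset.sum_nonneg fun p _ => hE p)
    _ = ∑ p ∈ C, ∑ c ∈ A, edgeWeight φ h p.1 p.2 := by
        rw [Finset.mul_sum]
        exact Finset.sum_congr rfl fun p _ => by rw [Finset.sum_const, nsmul_eq_mul]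
    _ ≤ ∑ p ∈ C, ∑ c ∈ A, (edgeWeight φ h p.1 c + edgeWeight φ h p.2 c +
          triWeight φ (p.1, p.2, c)) := by
        refine Finset.sum_le_sum fun p hp => Finset.sum_le_sum fun c hc => ?_
        have hp' := hCmem p hp
        rw [hA, Finset.mem_Icc] at hc
        exact edgeWeight_le_of_apex h (by omega) (by omega) (by omega) (by omega)
    _ ≤ _ := by
        simp only [Finset.sum_add_distrib]
        exact add_le_add (add_le_add e1 e2) e3

lemma exists_total_le (hφ : ∀ U V, φ U V = (φ V U)⁻¹) {m : ℕ} (h1 : 1 ≤ m) (h3 : 3 * m ≤ g)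
    (h4 : 4 * m ≤ g + 1) :
    ∃ h : Submodule F (Space F g) → Γ, m * highTotal φ h 0 ≤
      (1 + 25 * tailConst + 75 * tailConst ^ 2) * triTotal φ := by
  classical
  obtain ⟨h₀, hh₀⟩ := exists_highTotal_le hφ h1
  obtain ⟨h, e1, e2⟩ := exists_extension (φ := φ) h₀ h3
  have e3 := mul_sum_low_edgeWeight_le (φ := φ) h h1 h3 h4
  rw [← e1] at hh₀ e2
  refine ⟨h, ?_⟩
  set EB := ∑ i ∈ Finset.Icc 1 m, ∑ a ∈ Finset.Icc (3 * m) g, edgeWeight φ h i a with hEB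
  set C := (Finset.Icc 1 m ×ˢ Finset.Icc 1 (3 * m - 1)).filter (fun p => p.1 ≤ p.2) with hC
  have hE : ∀ p : ℕ × ℕ, 0 ≤ edgeWeight φ h p.1 p.2 := fun p => edgeWeight_nonneg _ _ _
  -- A pair a ≤ b is high if a > m, low-to-large if a ≤ m and b ≥ 3m, and lies in C otherwise.
  have htot : highTotal φ h 0 ≤ (highTotal φ h m + EB) + ∑ p ∈ C, edgeWeight φ h p.1 p.2 := by
    rw [hEB, ← Finset.sum_product' (Finset.Icc 1 m) _ (edgeWeight φ h)]
    refine (sum_union_le (T := highPairs g m ∪ Finset.Icc 1 m ×ˢ Finset.Icc (3 * m) g) (U := C) hE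
      fun p hp => ?_).trans (add_le_add_left (sum_union_le hE subset_rfl) _)
    rw [mem_highPairs] at hp
    simp only [hC, Finset.mem_union, mem_highPairs, Finset.mem_product, Finset.mem_Icc,
      Finset.mem_filter]
    omega
  have hK := tailConst_nonneg
  have hm0 : (0 : ℝ) ≤ m := Nat.cast_nonneg _
  have e4 : m * highTotal φ h 0 ≤ m * ((highTotal φ h m + EB) +
      ∑ p ∈ C, edgeWeight φ h p.1 p.2) := mul_le_mul_of_nonneg_left htot hm0
  have e5 : 3 * tailConst * (m * highTotal φ h m) ≤
      3 * tailConst * (5 * tailConst * triTotal φ) :=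
    mul_le_mul_of_nonneg_left hh₀ (by positivity)
  -- With T the triangle total and K = `tailConst`: m · high ≤ 5KT, m · EB ≤ (3K + 15K²)T, and the
  -- sum over C contributes at most 4m · EB + m · high + T. Altogether 2 · 5K + 5(3K + 15K²) + 1.
  nlinarith

end Total

/-! ### Chambers as translates of the standard flag, and the probability of a face. -/

section Transfer

variable {F : Type u} [Field F] {g : ℕ}

/-- The vertex of dimension `i + 1` of the translate by `γ` of the standard flag. -/
def flagVertex (γ : isomGroup F g) (i : Fin g) : Vertex F g :=
  ⟨γ • stdFlag F g (i + 1), ne_bot_of_finrank_pos (by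
    rw [finrank_smul, finrank_stdFlag i.2]; omega), (isIsotropic_stdFlag _).smul γ⟩

lemma finrank_flagVertex (γ : isomGroup F g) (i : Fin g) :
    finrank F (flagVertex γ i).1 = i + 1 := by
  rw [flagVertex, finrank_smul, finrank_stdFlag i.2]

/-- The translate by `γ` of the standard flag. -/
def flagEmb (γ : isomGroup F g) : Fin g ↪ Vertex F g :=
  ⟨flagVertex γ, fun i j h => Fin.ext (by
    have h1 := finrank_flagVertex γ i
    rw [h, finrank_flagVertex] at h1
    omega)⟩

/-- The chamber of the translate by `γ` of the standard flag. -/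
def chamber (γ : isomGroup F g) : Finset (Vertex F g) := Finset.univ.map (flagEmb γ)

lemma mem_chamber {γ : isomGroup F g} {U : Vertex F g} :
    U ∈ chamber γ ↔ ∃ i, flagVertex γ i = U := by
  simp only [chamber, Finset.mem_map, Finset.mem_univ, true_and]
  rfl

lemma flagVertex_le (γ : isomGroup F g) {i j : Fin g} (h : i ≤ j) :
    (flagVertex γ i).1 ≤ (flagVertex γ j).1 :=
  smul_le_smul_iff'.2 (stdFlag_mono (Nat.succ_le_succ h))

lemma mem_faces_of_subset_chamber {γ : isomGroup F g} {s : Finset (Vertex F g)} (hs : s.Nonempty)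
    (h : s ⊆ chamber γ) : s ∈ (symplecticBuilding F g).faces := by
  refine ⟨hs, fun U hU W hW => ?_⟩
  obtain ⟨i, rfl⟩ := mem_chamber.1 (h hU)
  obtain ⟨j, rfl⟩ := mem_chamber.1 (h hW)
  rcases le_total i j with hij | hij
  · exact Or.inl (flagVertex_le γ hij)
  · exact Or.inr (flagVertex_le γ hij)

lemma exists_subset_chamber {s : Finset (Vertex F g)} (hs : s ∈ (symplecticBuilding F g).faces) :
    ∃ γ : isomGroup F g, s ⊆ chamber γ := by
  obtain ⟨γ, hγ⟩ := exists_smul_stdFlag_eq {U | ∃ v ∈ s, v.1 = U}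
    (by rintro _ ⟨v, -, rfl⟩; exact v.2.2)
    (by rintro _ ⟨v, hv, rfl⟩ _ ⟨w, hw, rfl⟩; exact hs.2 v hv w hw)
  refine ⟨γ, fun v hv => mem_chamber.2 ?_⟩
  have h1 : 1 ≤ finrank F v.1 := by
    rw [Nat.one_le_iff_ne_zero, Ne, Submodule.finrank_eq_zero]
    exact v.2.1
  have h2 := v.2.2.finrank_le
  refine ⟨⟨finrank F v.1 - 1, by omega⟩, Subtype.ext ?_⟩
  change γ • stdFlag F g (finrank F v.1 - 1 + 1) = v.1
  rw [Nat.sub_add_cancel h1]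
  exact hγ v.1 ⟨v, hv, rfl⟩

/-- Every face lies in a chamber and all chambers have g vertices, so none is properly contained in
a face. -/
lemma maximal_chamber (hg : 1 ≤ g) (γ : isomGroup F g) :
    Maximal (· ∈ (symplecticBuilding F g).faces) (chamber γ) := by
  have hne : (chamber γ).Nonempty := ⟨flagVertex γ ⟨0, hg⟩, mem_chamber.2 ⟨_, rfl⟩⟩
  refine ⟨mem_faces_of_subset_chamber hne subset_rfl, fun t ht hle => ?_⟩
  obtain ⟨δ, hδ⟩ := exists_subset_chamber ht
  have : chamber γ = chamber δ :=
    Finset.eq_of_subset_of_card_le (le_trans hle hδ) (by simp [chamber])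
  rw [this]
  exact hδ

lemma exists_eq_chamber {s : Finset (Vertex F g)}
    (hs : Maximal (· ∈ (symplecticBuilding F g).faces) s) : ∃ γ : isomGroup F g, s = chamber γ := by
  obtain ⟨γ, hγ⟩ := exists_subset_chamber hs.prop
  have hc : chamber γ ∈ (symplecticBuilding F g).faces :=
    mem_faces_of_subset_chamber (hs.prop.1.mono hγ) subset_rfl
  exact ⟨γ, le_antisymm hγ (hs.le_of_ge hc hγ)⟩

/-- The oriented face with vertices in the positions `s` of the translate by `γ` of the standard
flag. -/
def orientedFlag {k : ℕ} (γ : isomGroup F g) (s : Fin (k + 1) ↪ Fin g) :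
    OrientedFace (symplecticBuilding F g) k :=
  ⟨s.trans (flagEmb γ), mem_faces_of_subset_chamber (γ := γ) (by simp) (by
    intro U hU
    obtain ⟨i, -, rfl⟩ := Finset.mem_map.1 hU
    exact mem_chamber.2 ⟨s i, rfl⟩)⟩

lemma exists_eq_orientedFlag {k : ℕ} {γ : isomGroup F g}
    (t : OrientedFace (symplecticBuilding F g) k) (h : t.toFinset ⊆ chamber γ) :
    ∃ s, t = orientedFlag γ s := by
  have hex : ∀ i, ∃ j, flagVertex γ j = t.1 i := fun i =>
    mem_chamber.1 (h (Finset.mem_map.2 ⟨i, Finset.mem_univ _, rfl⟩))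
  choose s hs using hex
  refine ⟨⟨s, fun i j hij => t.1.injective ?_⟩, Subtype.ext (DFunLike.ext _ _ fun i => (hs i).symm)⟩
  rw [← hs i, ← hs j, hij]

/-- The oriented flag together with its chamber. -/
def flagPair (hg : 1 ≤ g) {k : ℕ} (p : isomGroup F g × (Fin (k + 1) ↪ Fin g)) :
    TopPair (symplecticBuilding F g) k :=
  ⟨(chamber p.1, orientedFlag p.1 p.2), maximal_chamber hg p.1, fun U hU => by
    obtain ⟨i, -, rfl⟩ := Finset.mem_map.1 hU
    exact mem_chamber.2 ⟨p.2 i, rfl⟩⟩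

lemma flagPair_surjective (hg : 1 ≤ g) (k : ℕ) :
    Function.Surjective (flagPair (F := F) hg (k := k)) := by
  rintro ⟨⟨σ, t⟩, hσ, ht⟩
  obtain ⟨γ, rfl⟩ := exists_eq_chamber hσ
  obtain ⟨s, rfl⟩ := exists_eq_orientedFlag t ht
  exact ⟨(γ, s), rfl⟩

/-- The dimension of a vertex recovers its position in the flag, so both the full flag and the
positions can be read off. -/
lemma flagPair_eq_iff (hg : 1 ≤ g) {k : ℕ} (p q : isomGroup F g × (Fin (k + 1) ↪ Fin g)) :
    flagPair hg p = flagPair hg q ↔ (∀ i, flagVertex p.1 i = flagVertex q.1 i) ∧ p.2 = q.2 := by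
  have hdim : ∀ {γ δ : isomGroup F g} {i j : Fin g}, flagVertex γ i = flagVertex δ j → i = j := by
    intro γ δ i j h
    have h1 := finrank_flagVertex γ i
    rw [h, finrank_flagVertex] at h1
    exact Fin.ext (by omega)
  constructor
  · intro h
    have h1 : chamber p.1 = chamber q.1 := congrArg (fun x => x.1.1) h
    have h2 : orientedFlag p.1 p.2 = orientedFlag q.1 q.2 := congrArg (fun x => x.1.2) h
    refine ⟨fun i => ?_, DFunLike.ext _ _ fun i => ?_⟩
    · have : flagVertex p.1 i ∈ chamber q.1 := h1 ▸ mem_chamber.2 ⟨i, rfl⟩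
      obtain ⟨j, hj⟩ := mem_chamber.1 this
      rw [← hdim hj, hj, hdim hj]
    · exact hdim (congrArg (fun x : OrientedFace (symplecticBuilding F g) k => x.1 i) h2)
  · rintro ⟨h1, h2⟩
    have h3 : flagEmb p.1 = flagEmb q.1 := DFunLike.ext _ _ h1
    refine Subtype.ext (Prod.ext ?_ (Subtype.ext ?_))
    · simp only [flagPair, chamber, h3]
    · simp only [flagPair, orientedFlag, h3, h2]

open Classical in
lemma card_filter_comp_eq {A B : Type*} [Fintype A] {Φ : A → B} (hΦ : Function.Surjective Φ) {N : ℕ}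
    (hN : ∀ b, (Finset.univ.filter fun a => Φ a = b).card = N) (P : B → Prop) :
    (Finset.univ.filter fun a => P (Φ a)).card = Nat.card {b // P b} * N := by
  have : Fintype B := Fintype.ofSurjective Φ hΦ
  rw [Finset.card_eq_sum_card_fiberwise (f := Φ) (t := Finset.univ.filter P)
    (fun a ha => by simpa using ha), Nat.card_eq_fintype_card, Fintype.card_subtype,
    ← smul_eq_mul, ← Finset.sum_const]
  refine Finset.sum_congr rfl fun b hb => ?_
  rw [← hN b, Finset.filter_filter]
  congr 1
  ext a
  simp only [Finset.mem_filter, Finset.mem_univ, true_and, and_iff_right_iff_imp] at hb ⊢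
  rintro rfl
  exact hb

variable [Finite F]

open Classical in
-- Every fibre is in bijection with the stabilizer of the standard full flag, so uniform pairs push
-- forward to the uniform distribution.
lemma card_fiber_flagPair (hg : 1 ≤ g) {k : ℕ} (b : TopPair (symplecticBuilding F g) k) :
    (Finset.univ.filter fun p => flagPair hg p = b).card =
      (Finset.univ.filter fun σ : isomGroup F g =>
        ∀ i, flagVertex σ i = flagVertex 1 i).card := by
  obtain ⟨⟨γ, s⟩, rfl⟩ := flagPair_surjective hg k b
  have hmul : ∀ δ σ : isomGroup F g, ∀ i, (flagVertex (δ * σ) i).1 = δ • (flagVertex σ i).1 :=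
    fun δ σ i => mul_smul _ _ _
  refine (Finset.card_bij (fun σ _ => (γ * σ, s)) ?_ ?_ ?_).symm
  · intro σ hσ
    rw [Finset.mem_filter] at hσ ⊢
    refine ⟨Finset.mem_univ _, (flagPair_eq_iff hg _ _).2 ⟨fun i => Subtype.ext ?_, rfl⟩⟩
    rw [hmul, hσ.2 i, ← hmul, mul_one]
  · intro a _ b _ h
    exact mul_left_cancel (congrArg Prod.fst h)
  · rintro ⟨δ, t⟩ h
    rw [Finset.mem_filter, flagPair_eq_iff] at h
    obtain ⟨-, h1, rfl⟩ := h
    refine ⟨γ⁻¹ * δ, ?_, by simp⟩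
    rw [Finset.mem_filter]
    refine ⟨Finset.mem_univ _, fun i => Subtype.ext ?_⟩
    rw [hmul, h1 i, ← hmul, inv_mul_cancel]

lemma sum_ind_eq_card {A : Type*} [Fintype A] (P : A → Prop) [DecidablePred P] :
    ∑ a, ind (P a) = (Finset.univ.filter P).card := by
  rw [Finset.card_filter, Nat.cast_sum]
  refine Finset.sum_congr rfl fun a _ => ?_
  by_cases h : P a
  · rw [ind_true h, if_pos h, Nat.cast_one]
  · rw [ind_false h, if_neg h, Nat.cast_zero]

/-- The random oriented face is a uniformly random translate of a uniformly random ordered tuple in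
the standard flag. -/
lemma prob_eq (hg : 1 ≤ g) (k : ℕ) (E : OrientedFace (symplecticBuilding F g) k → Prop) :
    prob (symplecticBuilding F g) k E =
      (∑ s : Fin (k + 1) ↪ Fin g, ∑ γ : isomGroup F g, ind (E (orientedFlag γ s))) /
        (Fintype.card (isomGroup F g) * g.descFactorial (k + 1)) := by
  classical
  set N := (Finset.univ.filter fun σ : isomGroup F g => ∀ i, flagVertex σ i = flagVertex 1 i).card
    with hN
  have hNpos : (0 : ℝ) < N := Nat.cast_pos.2 (Finset.card_pos.2 ⟨1, by simp⟩)
  have hcount := card_filter_comp_eq (flagPair_surjective (F := F) hg k)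
    (card_fiber_flagPair hg)
  have h1 : ∑ s : Fin (k + 1) ↪ Fin g, ∑ γ : isomGroup F g, ind (E (orientedFlag γ s)) =
      Nat.card {p : TopPair (symplecticBuilding F g) k // E p.1.2} * N := by
    have h := hcount fun p => E p.1.2
    rw [Finset.sum_comm, ← Fintype.sum_prod_type'
      (f := fun (γ : isomGroup F g) (s : Fin (k + 1) ↪ Fin g) => ind (E (orientedFlag γ s))),
      hN, ← Nat.cast_mul, ← h, ← sum_ind_eq_card]
    rfl
  have h2 : (Fintype.card (isomGroup F g) * g.descFactorial (k + 1) : ℝ) =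
      Nat.card (TopPair (symplecticBuilding F g) k) * N := by
    have h := hcount fun _ => True
    simp only [Finset.filter_true, Finset.card_univ, Fintype.card_prod,
      Fintype.card_embedding_eq, Fintype.card_fin] at h
    rw [Nat.card_congr (Equiv.subtypeUnivEquiv fun _ => trivial)] at h
    rw [hN]
    exact_mod_cast h
  rw [h1, h2, prob, mul_div_mul_right _ _ hNpos.ne']

end Transfer

/-! ### From weights back to cochains, and the expansion inequality. -/

section Expansion

variable {F : Type u} [Field F] {g : ℕ} {Γ : Type w} [Group Γ]

open Classical in
/-- A cochain as a function of pairs of subspaces, with value `1` on pairs that are not edges. -/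
noncomputable def cochainFn (f : Cochain1 (symplecticBuilding F g) Γ)
    (U W : Submodule F (Space F g)) : Γ :=
  if h : ∃ e : OrientedFace (symplecticBuilding F g) 1, (e.vertex 0).1 = U ∧ (e.vertex 1).1 = W then
    f.1 h.choose else 1

lemma cochainFn_vertex (f : Cochain1 (symplecticBuilding F g) Γ)
    (e : OrientedFace (symplecticBuilding F g) 1) :
    cochainFn f (e.vertex 0).1 (e.vertex 1).1 = f.1 e := by
  have h : ∃ e' : OrientedFace (symplecticBuilding F g) 1,
    (e'.vertex 0).1 = (e.vertex 0).1 ∧ (e'.vertex 1).1 = (e.vertex 1).1 := ⟨e, rfl, rfl⟩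
  rw [cochainFn, dif_pos h]
  refine congrArg f.1 ?_
  refine Subtype.ext (Function.Embedding.ext fun i => ?_)
  fin_cases i
  · exact Subtype.ext h.choose_spec.1
  · exact Subtype.ext h.choose_spec.2

lemma cochainFn_self (f : Cochain1 (symplecticBuilding F g) Γ) (U : Submodule F (Space F g)) :
    cochainFn f U U = 1 := by
  refine dif_neg ?_
  rintro ⟨e, h0, h1⟩
  exact absurd (e.1.injective (Subtype.ext (h0.trans h1.symm))) (by decide)

lemma cochainFn_swap (f : Cochain1 (symplecticBuilding F g) Γ) (U W : Submodule F (Space F g)) :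
    cochainFn f U W = (cochainFn f W U)⁻¹ := by
  by_cases h : ∃ e : OrientedFace (symplecticBuilding F g) 1, (e.vertex 0).1 = U ∧ (e.vertex 1).1 = W
  · obtain ⟨e, rfl, rfl⟩ := h
    rw [cochainFn_vertex, f.2 e, ← cochainFn_vertex]
    rfl
  · have h' : ¬∃ e : OrientedFace (symplecticBuilding F g) 1,
        (e.vertex 0).1 = W ∧ (e.vertex 1).1 = U := by
      rintro ⟨e, h0, h1⟩
      exact h ⟨e.edge 1 0 (by decide), h1, h0⟩
    rw [cochainFn, cochainFn, dif_neg h, dif_neg h', inv_one]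

lemma cochainFn_edge (f : Cochain1 (symplecticBuilding F g) Γ) {k : ℕ}
    (t : OrientedFace (symplecticBuilding F g) k) {i j : Fin (k + 1)} (hij : i ≠ j) :
    f.1 (t.edge i j hij) = cochainFn f (t.vertex i).1 (t.vertex j).1 :=
  (cochainFn_vertex f _).symm

lemma delta1_ne_one_iff (f : Cochain1 (symplecticBuilding F g) Γ)
    (t : OrientedFace (symplecticBuilding F g) 2) :
    delta1 f t ≠ 1 ↔ BadTri (cochainFn f) (t.vertex 0).1 (t.vertex 1).1 (t.vertex 2).1 := by
  rw [delta1, cochainFn_edge, cochainFn_edge, cochainFn_edge, BadTri,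
    cochainFn_swap f (t.vertex 2).1, Ne, mul_inv_eq_one]

lemma ne_delta0_iff (f : Cochain1 (symplecticBuilding F g) Γ) (h : Submodule F (Space F g) → Γ)
    (e : OrientedFace (symplecticBuilding F g) 1) :
    f.1 e ≠ (delta0 (symplecticBuilding F g) fun v => h v.1).1 e ↔
      BadEdge (cochainFn f) h (e.vertex 0).1 (e.vertex 1).1 := by
  rw [BadEdge, cochainFn_vertex]
  rfl

lemma badTri_left_self (f : Cochain1 (symplecticBuilding F g) Γ) (U W : Submodule F (Space F g)) :
    ¬BadTri (cochainFn f) U U W := by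
  simp [BadTri, cochainFn_self]

lemma badTri_right_self (f : Cochain1 (symplecticBuilding F g) Γ) (U W : Submodule F (Space F g)) :
    ¬BadTri (cochainFn f) U W W := by
  simp [BadTri, cochainFn_self]

lemma badEdge_swap (f : Cochain1 (symplecticBuilding F g) Γ) (h : Submodule F (Space F g) → Γ)
    (U W : Submodule F (Space F g)) :
    BadEdge (cochainFn f) h U W ↔ BadEdge (cochainFn f) h W U := by
  rw [BadEdge, BadEdge, cochainFn_swap f U W, Ne, Ne, inv_eq_iff_eq_inv, mul_inv_rev, inv_inv]

variable [Finite F]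

/-- Types with a repeated dimension have weight zero because `cochainFn f U U = 1`. The remaining
types a < b < c are increasing triples of positions, position i having dimension i + 1. -/
lemma triTotal_le_sum (f : Cochain1 (symplecticBuilding F g) Γ) :
    triTotal (cochainFn f) ≤ ∑ s : Fin 3 ↪ Fin g, ∑ γ : isomGroup F g,
      ind (delta1 f (orientedFlag γ s) ≠ 1) := by
  classical
  let ι : (Fin 3 ↪ Fin g) → ℕ × ℕ × ℕ := fun s => (s 0 + 1, s 1 + 1, s 2 + 1)
  have hι : Function.Injective ι := by
    intro s t h
    simp only [ι, Prod.mk.injEq, add_left_inj] at h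
    refine DFunLike.ext _ _ fun i => Fin.ext ?_
    fin_cases i
    exacts [h.1, h.2.1, h.2.2]
  have hsupp : ∀ t : ℕ × ℕ × ℕ, triWeight (cochainFn f) t ≠ 0 → t ∈ Finset.univ.image ι := by
    rintro ⟨a, b, c⟩ ht
    have hab : a ≠ b := by
      rintro rfl
      refine ht ?_
      rw [triWeight]
      split_ifs
      · exact Finset.sum_eq_zero fun γ _ => ind_false (badTri_left_self f _ _)
      · rfl
    have hbc : b ≠ c := by
      rintro rfl
      refine ht ?_
      rw [triWeight]
      split_ifs
      · exact Finset.sum_eq_zero fun γ _ => ind_false (badTri_right_self f _ _)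
      · rfl
    rw [triWeight] at ht
    split_ifs at ht with hle
    · simp only at hle
      refine Finset.mem_image.2 ⟨⟨![⟨a - 1, by omega⟩, ⟨b - 1, by omega⟩, ⟨c - 1, by omega⟩], ?_⟩,
        Finset.mem_univ _, ?_⟩
      · intro i j hij
        fin_cases i <;> fin_cases j <;> simp at hij ⊢ <;> omega
      · simp only [ι, Prod.mk.injEq]
        refine ⟨?_, ?_, ?_⟩
        · change a - 1 + 1 = a; omega
        · change b - 1 + 1 = b; omega
        · change c - 1 + 1 = c; omega
    · exact (ht rfl).elim
  refine (sum_le_sum_of_support triWeight_nonneg hsupp _).trans ?_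
  rw [Finset.sum_image hι.injOn]
  refine Finset.sum_le_sum fun s _ => ?_
  rw [triWeight]
  split_ifs
  · exact Finset.sum_le_sum fun γ _ => ind_mono fun h => (delta1_ne_one_iff f _).2 h
  · exact Finset.sum_nonneg fun γ _ => ind_nonneg _

/-- The factor 2 counts the two orientations of an edge, which are bad simultaneously. -/
lemma sum_le_highTotal (f : Cochain1 (symplecticBuilding F g) Γ)
    (h : Submodule F (Space F g) → Γ) :
    ∑ s : Fin 2 ↪ Fin g, ∑ γ : isomGroup F g,
      ind (f.1 (orientedFlag γ s) ≠ (delta0 (symplecticBuilding F g) fun v => h v.1).1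
        (orientedFlag γ s)) ≤ 2 * highTotal (cochainFn f) h 0 := by
  classical
  have hterm : ∀ s : Fin 2 ↪ Fin g, ∑ γ : isomGroup F g,
      ind (f.1 (orientedFlag γ s) ≠ (delta0 (symplecticBuilding F g) fun v => h v.1).1
        (orientedFlag γ s)) = edgeWeight (cochainFn f) h (s 0 + 1) (s 1 + 1) := fun s =>
    Finset.sum_congr rfl fun γ _ => congrArg ind (propext (ne_delta0_iff f h _))
  have hsymm : ∀ a b, edgeWeight (cochainFn f) h a b = edgeWeight (cochainFn f) h b a := fun a b =>
    Finset.sum_congr rfl fun γ _ => congrArg ind (propext (badEdge_swap f h _ _))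
  let ι : (Fin 2 ↪ Fin g) → ℕ × ℕ := fun s => (s 0 + 1, s 1 + 1)
  let ι' : (Fin 2 ↪ Fin g) → ℕ × ℕ := fun s => (s 1 + 1, s 0 + 1)
  have hι : Function.Injective ι := by
    intro s t h
    simp only [ι, Prod.mk.injEq, add_left_inj] at h
    refine DFunLike.ext _ _ fun i => Fin.ext ?_
    fin_cases i
    exacts [h.1, h.2]
  have hι' : Function.Injective ι' := by
    intro s t h
    simp only [ι', Prod.mk.injEq, add_left_inj] at h
    refine DFunLike.ext _ _ fun i => Fin.ext ?_
    fin_cases i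
    exacts [h.2, h.1]
  have hbound : ∀ (S : Finset (Fin 2 ↪ Fin g)) (κ : (Fin 2 ↪ Fin g) → ℕ × ℕ),
      Function.Injective κ → (∀ s ∈ S, κ s ∈ highPairs g 0) →
      ∑ s ∈ S, edgeWeight (cochainFn f) h (κ s).1 (κ s).2 ≤ highTotal (cochainFn f) h 0 := by
    intro S κ hκ hS
    rw [← Finset.sum_image (f := fun p : ℕ × ℕ => edgeWeight (cochainFn f) h p.1 p.2) hκ.injOn]
    refine Finset.sum_le_sum_of_subset_of_nonneg (fun p hp => ?_) fun p _ _ =>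
      edgeWeight_nonneg _ _ _
    obtain ⟨s, hs, rfl⟩ := Finset.mem_image.1 hp
    exact hS s hs
  rw [Finset.sum_congr rfl fun s _ => hterm s,
    ← Finset.sum_filter_add_sum_filter_not Finset.univ fun s : Fin 2 ↪ Fin g => s 0 ≤ s 1, two_mul]
  refine add_le_add (hbound _ ι hι fun s hs => ?_) ?_
  · have h1 := Fin.le_def.1 (Finset.mem_filter.1 hs).2
    rw [mem_highPairs]
    simp only [ι]
    omega
  · rw [Finset.sum_congr rfl fun s _ => hsymm _ _]
    refine hbound _ ι' hι' fun s hs => ?_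
    have h1 := Fin.lt_def.1 (not_le.1 (Finset.mem_filter.1 hs).2)
    rw [mem_highPairs]
    simp only [ι']
    omega

/-- The inverse of the expansion constant. -/
noncomputable def expansionConst : ℝ := 12 * (1 + 25 * tailConst + 75 * tailConst ^ 2)

lemma expansionConst_pos : 0 < expansionConst := by
  have := tailConst_nonneg
  unfold expansionConst
  positivity

/-- Every cochain is close to a coboundary. -/
lemma exists_cochainDist_le (hg : 3 ≤ g) (f : Cochain1 (symplecticBuilding F g) Γ) :
    ∃ h : Vertex F g → Γ, cochainDist f.1 (delta0 (symplecticBuilding F g) h).1 ≤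
      expansionConst * wt (delta1 f) := by
  -- For g ≥ 3 this gives m ≥ 1, 3m ≤ g and 4m ≤ g + 1, while rounding down still leaves 6m ≥ g - 2.
  set m := (g + 3) / 6 with hm
  obtain ⟨h, hh⟩ := exists_total_le (cochainFn_swap f) (m := m) (by omega) (by omega) (by omega)
  refine ⟨fun v => h v.1, ?_⟩
  have hdist := prob_eq (F := F) (by omega : 1 ≤ g) 1 fun e =>
    f.1 e ≠ (delta0 (symplecticBuilding F g) fun v => h v.1).1 e
  have hwt := prob_eq (F := F) (by omega : 1 ≤ g) 2 fun t => delta1 f t ≠ 1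
  rw [wt, cochainDist, cochainDist, hdist, hwt]
  have e1 := sum_le_highTotal f h
  have e2 := triTotal_le_sum f
  set X := ∑ s : Fin 2 ↪ Fin g, ∑ γ : isomGroup F g,
      ind (f.1 (orientedFlag γ s) ≠ (delta0 (symplecticBuilding F g) fun v => h v.1).1
        (orientedFlag γ s)) with hX
  set Y := ∑ s : Fin 3 ↪ Fin g, ∑ γ : isomGroup F g, ind (delta1 f (orientedFlag γ s) ≠ 1) with hY
  have hn : (0 : ℝ) < Fintype.card (isomGroup F g) := Nat.cast_pos.2 Fintype.card_pos
  have hd : (0 : ℝ) < g.descFactorial 2 := Nat.cast_pos.2 (Nat.descFactorial_pos.2 (by omega))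
  -- The ratio g - 2 between ordered triples and ordered pairs is absorbed by the gain m; with the
  -- two orientations this gives the 12 in `expansionConst`.
  have hsucc : (g.descFactorial 3 : ℝ) = ((g - 2 : ℕ) : ℝ) * g.descFactorial 2 := by
    rw [Nat.descFactorial_succ, Nat.cast_mul]
  have hg2 : (0 : ℝ) < ((g - 2 : ℕ) : ℝ) := Nat.cast_pos.2 (by omega)
  have hgm : ((g - 2 : ℕ) : ℝ) ≤ 6 * m := by exact_mod_cast (by omega : g - 2 ≤ 6 * m)
  have hX0 : 0 ≤ X := Finset.sum_nonneg fun s _ => Finset.sum_nonneg fun γ _ => ind_nonneg _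
  change X / (_ * (g.descFactorial 2 : ℝ)) ≤ expansionConst * (Y / (_ * (g.descFactorial 3 : ℝ)))
  rw [hsucc]
  have hK := tailConst_nonneg
  have hmain : ((g - 2 : ℕ) : ℝ) * X ≤ expansionConst * Y := by
    calc ((g - 2 : ℕ) : ℝ) * X ≤ 6 * m * X := mul_le_mul_of_nonneg_right hgm hX0
      _ ≤ 6 * m * (2 * highTotal (cochainFn f) h 0) :=
        mul_le_mul_of_nonneg_left e1 (by positivity)
      _ = 12 * (m * highTotal (cochainFn f) h 0) := by ring
      _ ≤ 12 * ((1 + 25 * tailConst + 75 * tailConst ^ 2) * triTotal (cochainFn f)) := by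
        linarith
      _ = expansionConst * triTotal (cochainFn f) := by rw [expansionConst]; ring
      _ ≤ expansionConst * Y := mul_le_mul_of_nonneg_left e2 expansionConst_pos.le
  rw [← mul_div_assoc, div_le_div_iff₀ (by positivity) (by positivity)]
  calc X * (Fintype.card (isomGroup F g) * (((g - 2 : ℕ) : ℝ) * g.descFactorial 2)) =
        (((g - 2 : ℕ) : ℝ) * X) * (Fintype.card (isomGroup F g) * g.descFactorial 2) := by ring
    _ ≤ _ := mul_le_mul_of_nonneg_right hmain (by positivity)

/-- Every edge lies in some chamber, so a single disagreement already has positive probability. -/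
lemma eq_of_cochainDist_le_zero (hg : 1 ≤ g) {f f' : Cochain1 (symplecticBuilding F g) Γ}
    (h : cochainDist f.1 f'.1 ≤ 0) : f = f' := by
  rw [cochainDist, prob_eq hg] at h
  have hn : (0 : ℝ) < Fintype.card (isomGroup F g) := Nat.cast_pos.2 Fintype.card_pos
  refine Subtype.ext (funext fun e => ?_)
  obtain ⟨γ, hγ⟩ := exists_subset_chamber e.2
  obtain ⟨s, rfl⟩ := exists_eq_orientedFlag e hγ
  have hd : (0 : ℝ) < g.descFactorial (1 + 1) := by
    refine Nat.cast_pos.2 (Nat.descFactorial_pos.2 ?_)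
    simpa using Fintype.card_le_of_embedding s
  by_contra hne
  have hpos : 0 < ∑ s : Fin 2 ↪ Fin g, ∑ γ : isomGroup F g,
      ind (f.1 (orientedFlag γ s) ≠ f'.1 (orientedFlag γ s)) := by
    refine Finset.sum_pos' (fun s _ => Finset.sum_nonneg fun γ _ => ind_nonneg _)
      ⟨s, Finset.mem_univ _, Finset.sum_pos' (fun γ _ => ind_nonneg _)
        ⟨γ, Finset.mem_univ _, ?_⟩⟩
    rw [ind_true hne]
    exact one_pos
  exact absurd h (not_le.2 (div_pos hpos (by positivity)))

lemma delta0_mem_Z1 {V : Type v} (X : AbstractSimplicialComplex V) (h : V → Γ) :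
    delta0 X h ∈ Z1 X Γ := by
  intro t
  change (h (t.vertex 0) * (h (t.vertex 1))⁻¹) * (h (t.vertex 1) * (h (t.vertex 2))⁻¹) *
    (h (t.vertex 2) * (h (t.vertex 0))⁻¹) = 1
  group

lemma isCoboundaryExpander (hg : 3 ≤ g) :
    IsCoboundaryExpander.{u, w} (symplecticBuilding F g) expansionConst⁻¹ := by
  refine ⟨fun Γ _ f => ?_, fun Γ _ => Set.Subset.antisymm (fun f hf => ?_) ?_⟩
  · obtain ⟨h, hh⟩ := exists_cochainDist_le hg f
    exact ⟨_, delta0_mem_Z1 _ h, (inv_mul_le_iff₀ expansionConst_pos).2 hh⟩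
  · obtain ⟨h, hh⟩ := exists_cochainDist_le hg f
    -- A cocycle has no violated triangle, so its distance to the coboundary found is zero.
    have hwt : wt (delta1 f) = 0 := by
      rw [wt, cochainDist, prob_eq (by omega),
        Finset.sum_eq_zero fun s _ => Finset.sum_eq_zero fun γ _ => ind_false (not_not.2 (hf _)),
        zero_div]
    rw [hwt, mul_zero] at hh
    exact ⟨h, (eq_of_cochainDist_le_zero (by omega) hh).symm⟩
  · rintro _ ⟨h, rfl⟩
    exact delta0_mem_Z1 _ h

end Expansion

end SympBuilding

theorem theorem6p1 :
    ∃ β : ℝ, 0 < β ∧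
      ∀ (g : ℕ), 3 ≤ g → ∀ (F : Type u) [Field F] [Finite F],
        SympBuilding.IsCoboundaryExpander.{u, w} (SympBuilding.symplecticBuilding F g) β :=
  ⟨_, inv_pos.2 SympBuilding.expansionConst_pos, fun _ hg _ _ _ =>
    SympBuilding.isCoboundaryExpander hg⟩
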